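/- **Variable-time non-global maxima.** Let $\varepsilon>0$, $T=\pi/\varepsilon$, $\gamma\in\mathbb R$, and put $b=\tfrac52(1-\sqrt3)$, $c=\sqrt3-3$, $d=3$, $g=\sqrt{\tfrac{3}{71}(19+12\sqrt3)}$, $r=\tfrac29(3-\sqrt3)$, $s=\sqrt{1-r^2}$, $\varphi=\tfrac\pi3$, $\theta=-\tfrac\pi3$, $$H_0=\operatorname{diag}(1+\varepsilon,1,2,3),\qquad H_1=\begin{pmatrix}0&1&0&0\\1&b&1&0\\0&1&c&g\\0&0&g&d\end{pmatrix},\qquad V^\dagger=\begin{pmatrix}r&0&0&s\,e^{i(\theta-\gamma)}\\0&-i&0&0\\0&0&e^{i\varphi}&0\\-s\,e^{i\gamma}&0&0&r\,e^{i\theta}\end{pmatrix}e^{iTH_0}.$$ Then $H_0,H_1$ are Hermitian and $V$ is unitary. For $(\ell,f)\in\mathbb R\oplus L^2(0,T)$ (real-valued $f$) the equation $i\dot U(t)=(\ell H_0+f(t)H_1)U(t)$, $U(0)=I$, has a unique continuous solution $U_{\ell,f}$ on $[0,T]$ (in the integrated sense). Let $\mathfrak F(\ell,f)=\tfrac14\operatorname{Re}\operatorname{Tr}[V^\dagger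 U_{\ell,f}(T)]$ be the gate fidelity. Then: 1. $\mathfrak F(1,0)=\tfrac1{24}(9-2\sqrt3)\approx0.23$; equivalently, the fidelity rescaled to run from $0$ to $1$ is $\tfrac12(1+\mathfrak F(1,0))=\tfrac1{48}(33-2\sqrt3)\approx62\%$. 2. $\mathfrak F$ is twice continuously (Fréchet) differentiable at $(1,0)$, and $(1,0)$ is a critical point of $\mathfrak F$, that is, $D\mathfrak F(1,0)=0$. 3. Write $\Pi[h]$ for the unnormalized projection $\alpha\mapsto\bigl(\int_0^T h\alpha\bigr)h$ on $L^2(0,T)$, identified with the bilinear form $(\alpha,\beta)\mapsto\int_0^T h\alpha\int_0^T h\beta$, and $P_\omega=\Pi[\cos(\omega\,\cdot)]+\Pi[\sin(\omega\,\cdot)]$. The Hessian of $\mathfrak F$ at $(1,0)$ is the bilinear form on $\mathbb R\oplus L^2(0,T)$ $$-\tfrac14\Bigl[\,C\,T^2\,d\ell^2+\bigl(9-4\sqrt3-\tfrac2\pi\bigr)\Pi[1]+\bigl(1+\tfrac1{\sqrt3}\bigr)P_1+r\,P_\varepsilon+\sum_{k=1}^\infty\frac{4}{\pi(4k^2-1)}P_{2k\varepsilon}\Bigr],\qquad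 C=r(1+\varepsilon)^2+5-\sqrt3\ \ge\ 3.5 .$$ 4. This Hessian is negative definite: $D^2\mathfrak F(1,0)[v,v]<0$ for all $0\ne v\in\mathbb R\oplus L^2(0,T)$. Consequently, $(1,0)$ is a strict local maximum of $\mathfrak F$ restricted to $(1,0)+E$, for every finite-dimensional subspace $E\subset\mathbb R\oplus L^2(0,T)$. 5. It is not a global maximum: there is $(\ell,f)\in\mathbb R\oplus L^2(0,T)$ with $\ell>0$ and $\mathfrak F(\ell,f)>\mathfrak F(1,0)$. So traps persist even when the final time may vary. -/

import Mathlib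

open MeasureTheory Matrix Complex

namespace QuantumTrap

noncomputable section

/-- The space `L²(0,T)` of real control fields. -/
abbrev Control (T : ℝ) : Type := Lp ℝ 2 (volume.restrict (Set.Ioc (0 : ℝ) T))

/-- `U` solves `i U' = (ℓ H₀ + f(t) H₁) U`, `U(0) = I` on `[0,T]`. As `f` is only an `L²` function,
a solution is a continuous `U` that satisfies the equation in integrated form
`U(t) = I - i ∫₀ᵗ (ℓ H₀ + f(s) H₁) U(s) ds` (written here entry by entry). -/
def IsPropagator {N : ℕ} (H₀ H₁ : Matrix (Fin N) (Fin N) ℂ) (T ℓ : ℝ) (f : ℝ → ℝ)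
    (U : ℝ → Matrix (Fin N) (Fin N) ℂ) : Prop :=
  ContinuousOn U (Set.Icc 0 T) ∧
    ∀ t ∈ Set.Icc (0 : ℝ) T, ∀ i j,
      U t i j = (1 : Matrix (Fin N) (Fin N) ℂ) i j
        - I * ∫ s in (0 : ℝ)..t, (((ℓ : ℂ) • H₀ + (f s : ℂ) • H₁) * U s) i j

open Classical in
/-- The final propagator `U(T)`, where `U` is the solution of the Schrödinger equation on `[0,T]`.
(The value `0` in the absence of a solution never occurs: existence and uniqueness of the solution
are part of the theorem.) -/
def finalPropagator {N : ℕ} (H₀ H₁ : Matrix (Fin N) (Fin N) ℂ) (T ℓ : ℝ) (f : ℝ → ℝ) :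
    Matrix (Fin N) (Fin N) ℂ :=
  if h : ∃ U, IsPropagator H₀ H₁ T ℓ f U then h.choose T else 0

/-- The gate fidelity `(1/N) Re Tr (V† U)`. -/
def gateFidelity {N : ℕ} (V U : Matrix (Fin N) (Fin N) ℂ) : ℝ :=
  1 / (N : ℝ) * (Vᴴ * U).trace.re

/-- The objective of the variable-time framework, a functional of `(ℓ, f) ∈ ℝ ⊕ L²(0,T)`. -/
def objective {N : ℕ} (H₀ H₁ V : Matrix (Fin N) (Fin N) ℂ) (T : ℝ) (p : ℝ × Control T) : ℝ :=
  gateFidelity V (finalPropagator H₀ H₁ T p.1 (p.2 : ℝ → ℝ))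

/-! ### The four-level system -/

def drift (ε : ℝ) : Matrix (Fin 4) (Fin 4) ℂ :=
  Matrix.diagonal ![1 + (ε : ℂ), 1, 2, 3]

def coupling (b c d g : ℝ) : Matrix (Fin 4) (Fin 4) ℂ :=
  !![0, 1, 0, 0;
     1, (b : ℂ), 1, 0;
     0, 1, (c : ℂ), (g : ℂ);
     0, 0, (g : ℂ), (d : ℂ)]

/-- The first factor of `V†`, where `s = √(1 - r²)`. -/
def targetCore (r θ φ γ : ℝ) : Matrix (Fin 4) (Fin 4) ℂ :=
  !![(r : ℂ), 0, 0, (√(1 - r ^ 2) : ℂ) * exp (I * ((θ : ℂ) - (γ : ℂ)));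
     0, -I, 0, 0;
     0, 0, exp (I * (φ : ℂ)), 0;
     -(√(1 - r ^ 2) : ℂ) * exp (I * (γ : ℂ)), 0, 0, (r : ℂ) * exp (I * (θ : ℂ))]

/-- The target gate `V`, given by `V† = targetCore · e^{i T H₀}`. -/
def target (H₀ : Matrix (Fin 4) (Fin 4) ℂ) (T r θ φ γ : ℝ) : Matrix (Fin 4) (Fin 4) ℂ :=
  (targetCore r θ φ γ * NormedSpace.exp ((I * (T : ℂ)) • H₀))ᴴ

/-! ### The specified parameters -/

/-- The target time `T = π / ε`. -/
def finalTime (ε : ℝ) : ℝ := Real.pi / ε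

def bPar : ℝ := 5 / 2 * (1 - √3)
def cPar : ℝ := √3 - 3
def dPar : ℝ := 3
def gPar : ℝ := √(3 / 71 * (19 + 12 * √3))
def rPar : ℝ := 2 / 9 * (3 - √3)
def φPar : ℝ := Real.pi / 3
def θPar : ℝ := -(Real.pi / 3)

/-- The control Hamiltonian `H₁` with the specified parameters. -/
def control : Matrix (Fin 4) (Fin 4) ℂ := coupling bPar cPar dPar gPar

/-- The target gate `V` with the specified parameters. -/
def gate (ε γ : ℝ) : Matrix (Fin 4) (Fin 4) ℂ :=
  target (drift ε) (finalTime ε) rPar θPar φPar γ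

/-- The fidelity of the four-level problem, as a functional of `(ℓ, f)`. -/
def fidelity (ε γ : ℝ) : ℝ × Control (finalTime ε) → ℝ :=
  objective (drift ε) control (gate ε γ) (finalTime ε)

/-! ### The operators in terms of which the Hessian is expressed -/

/-- The bilinear form `⟨β, Π[h] α⟩` of the unnormalized projection onto `h`. -/
def projForm {T : ℝ} (h : ℝ → ℝ) (α β : Control T) : ℝ :=
  (∫ t in (0 : ℝ)..T, h t * (α : ℝ → ℝ) t) * ∫ t in (0 : ℝ)..T, h t * (β : ℝ → ℝ) t

/-- The bilinear form of `Π[cos (ω •)] + Π[sin (ω •)]`. -/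
def harmonicForm {T : ℝ} (ω : ℝ) (α β : Control T) : ℝ :=
  projForm (fun t => Real.cos (ω * t)) α β + projForm (fun t => Real.sin (ω * t)) α β

/-- The coefficient `C` of `T² dℓ²` in the Hessian. -/
def timeCoeff (ε : ℝ) : ℝ := rPar * (1 + ε) ^ 2 + 5 - √3

end

end QuantumTrap

namespace QuantumTrap

noncomputable section

/-! ### Volterra operators with square-integrable kernels -/

section Volterra

variable {E : Type*} [NormedAddCommGroup E] [NormedSpace ℝ E] {T : ℝ}

/-! In the interaction picture `W(t) = e^{itH₀} U(t)`, the Schrödinger equation reads `(1 - K) W =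
I`, where `K` is a Volterra operator depending linearly on `(ℓ - 1, f)`. A control that is only
square integrable still gives `‖Kⁿ‖² ≤ (MT)ⁿ / n!`, so `1 - K` is always invertible
(`IsVolterraBounded.isUnit_one_sub`). Existence and uniqueness follow, and the fidelity becomes a
fixed linear functional `Λ` of the resolvent `(1 - K)⁻¹`. It is therefore smooth, with first
derivative `Λ(K_a)` and second derivative `Λ(K_a K_b + K_b K_a)` at `(1, 0)`, where `K = 0`
(`fderiv_fderiv_inverse_one_sub`).

The parameters are tuned to these two Dyson terms. Once `φ`, `θ`, `d` are given, `r` and `b` make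
the first-order integrand vanish at every time, `c` removes the mixed terms in `ℓ` and `f`, and `g`
cancels `sin (t - s)` in the second-order kernel. What remains (`overlap_interaction_interaction`)
is `-1/4` times `(9 - 4√3) + r cos εu - sin εu + (1 + 1/√3) cos u` with `u = t - s`, integrated over
the triangle `s < t`.

Symmetrizing fills the square and turns each cosine kernel into a sum of two squares
(`causalForm_cos_symm`). Only `-sin εu` has the wrong form. Because `T = π/ε`, the argument `εu`
stays in `[0, π]`, where `2/π - sin` is a cosine series with positive coefficients (`hasSum_sin`).
The correction `-2/π` is absorbed by the constant `9 - 4√3`. So minus the Hessian is a sum of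
nonnegative terms. The frequencies `2kε = 2πk/T`, together with the constant, form a complete system
on `(0, T)`, and Parseval gives definiteness.

On a finite-dimensional subspace, compactness of the unit sphere makes the Hessian uniformly
negative, hence the strict local maximum. A better point is found by pure drift, with `(ℓ - 1) T =
7π/6`. -/

theorem Control.integrable (f : Control T) :
    Integrable (f : ℝ → ℝ) (volume.restrict (Set.Ioc 0 T)) :=
  (Lp.memLp f).integrable (by norm_num)

theorem Control.intervalIntegrable (f : Control T) (hT : 0 ≤ T) :
    IntervalIntegrable (f : ℝ → ℝ) volume 0 T := by
  rw [intervalIntegrable_iff_integrableOn_Ioc_of_le hT]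
  exact f.integrable

theorem Control.intervalIntegrable_of_mem (f : Control T) {t : ℝ} (ht : t ∈ Set.Icc 0 T) :
    IntervalIntegrable (f : ℝ → ℝ) volume 0 t :=
  (f.intervalIntegrable (ht.1.trans ht.2)).mono_set (by
    rw [Set.uIcc_of_le ht.1, Set.uIcc_of_le (ht.1.trans ht.2)]
    exact Set.Icc_subset_Icc_right ht.2)

theorem Control.ae_of_ae {f : Control T} {p : ℝ → ℝ → Prop}
    (h : ∀ᵐ s ∂(volume.restrict (Set.Ioc 0 T)), p s (f s)) {t : ℝ} (ht : t ∈ Set.Icc 0 T) :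
    ∀ᵐ s, s ∈ Set.uIoc 0 t → p s (f s) := by
  rw [ae_restrict_iff' measurableSet_Ioc] at h
  filter_upwards [h] with s hs hst
  rw [Set.uIoc_of_le ht.1] at hst
  exact hs ⟨hst.1, hst.2.trans ht.2⟩

theorem Control.integral_sq_eq (f : Control T) :
    ∫ s in Set.Ioc 0 T, (f s) ^ 2 = ‖f‖ ^ 2 := by
  have h := L2.inner_def (𝕜 := ℝ) f f
  rw [real_inner_self_eq_norm_sq] at h
  rw [h]
  refine integral_congr_ae (Filter.Eventually.of_forall fun s => ?_)
  simp [pow_two]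

theorem Control.integrable_sq (f : Control T) :
    Integrable (fun s => (f s) ^ 2) (volume.restrict (Set.Ioc 0 T)) :=
  (Lp.memLp f).integrable_sq

theorem Control.intervalIntegrable_smul (f : Control T) {g : ℝ → E} (hg : Continuous g) {t : ℝ}
    (ht : t ∈ Set.Icc 0 T) : IntervalIntegrable (fun s => f s • g s) volume 0 t :=
  (f.intervalIntegrable_of_mem ht).smul_continuousOn hg.continuousOn

/-- Cauchy-Schwarz for the integral of a control against a continuous function. -/
theorem Control.norm_integral_smul_sq_le (f : Control T) {g : ℝ → E} (hg : Continuous g) {t : ℝ}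
    (ht : t ∈ Set.Icc 0 T) :
    ‖∫ s in (0 : ℝ)..t, f s • g s‖ ^ 2 ≤ ‖f‖ ^ 2 * ∫ s in (0 : ℝ)..t, ‖g s‖ ^ 2 := by
  have hsub : Set.Ioc 0 t ⊆ Set.Ioc 0 T := Set.Ioc_subset_Ioc_right ht.2
  have hle : volume.restrict (Set.Ioc 0 t) ≤ volume.restrict (Set.Ioc 0 T) :=
    Measure.restrict_mono_set _ hsub
  have hf : MemLp (fun s => ‖f s‖) 2 (volume.restrict (Set.Ioc 0 t)) :=
    ((Lp.memLp f).mono_measure hle).norm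
  have hg2 : MemLp (fun s => ‖g s‖) 2 (volume.restrict (Set.Ioc 0 t)) := by
    rw [memLp_two_iff_integrable_sq hg.norm.aestronglyMeasurable]
    exact ((hg.norm.pow 2).intervalIntegrable 0 t).1
  have h1 : ‖∫ s in (0 : ℝ)..t, f s • g s‖ ≤ ∫ s in Set.Ioc 0 t, ‖f s‖ * ‖g s‖ := by
    refine (intervalIntegral.norm_integral_le_integral_norm ht.1).trans (le_of_eq ?_)
    rw [intervalIntegral.integral_of_le ht.1]
    simp_rw [norm_smul]
  have h2 := integral_mul_le_Lp_mul_Lq_of_nonneg (μ := volume.restrict (Set.Ioc 0 t))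
    (Real.HolderConjugate.two_two) (f := fun s => ‖f s‖) (g := fun s => ‖g s‖)
    (Filter.Eventually.of_forall fun s => norm_nonneg _)
    (Filter.Eventually.of_forall fun s => norm_nonneg _) (by simpa using hf) (by simpa using hg2)
  have hF : (∫ s in Set.Ioc 0 t, ‖f s‖ ^ (2 : ℝ)) ≤ ‖f‖ ^ 2 := by
    rw [← f.integral_sq_eq]
    simp only [Real.rpow_two, Real.norm_eq_abs, sq_abs]
    exact setIntegral_mono_set f.integrable_sq (Filter.Eventually.of_forall fun s => sq_nonneg _)
      hsub.eventuallyLE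
  have hF0 : 0 ≤ ∫ s in Set.Ioc 0 t, ‖f s‖ ^ (2 : ℝ) := integral_nonneg fun s => by positivity
  have hG0 : 0 ≤ ∫ s in Set.Ioc 0 t, ‖g s‖ ^ (2 : ℝ) := integral_nonneg fun s => by positivity
  calc ‖∫ s in (0 : ℝ)..t, f s • g s‖ ^ 2
      ≤ ((∫ s in Set.Ioc 0 t, ‖f s‖ ^ (2 : ℝ)) ^ (1 / 2 : ℝ) *
          (∫ s in Set.Ioc 0 t, ‖g s‖ ^ (2 : ℝ)) ^ (1 / 2 : ℝ)) ^ 2 := by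
        exact pow_le_pow_left₀ (norm_nonneg _) (h1.trans h2) 2
    _ = (∫ s in Set.Ioc 0 t, ‖f s‖ ^ (2 : ℝ)) * ∫ s in Set.Ioc 0 t, ‖g s‖ ^ (2 : ℝ) := by
        rw [mul_pow, ← Real.sqrt_eq_rpow, ← Real.sqrt_eq_rpow, Real.sq_sqrt hF0, Real.sq_sqrt hG0]
    _ ≤ ‖f‖ ^ 2 * ∫ s in (0 : ℝ)..t, ‖g s‖ ^ 2 := by
        rw [intervalIntegral.integral_of_le ht.1]
        simp only [Real.rpow_two] at hF hG0 ⊢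
        exact mul_le_mul_of_nonneg_right hF hG0

theorem continuous_IccExtend {E : Type*} [TopologicalSpace E] (hT : 0 ≤ T)
    (x : C(Set.Icc 0 T, E)) : Continuous (Set.IccExtend hT x) := x.continuous.Icc_extend'

theorem norm_IccExtend_le {E : Type*} [NormedAddCommGroup E] (hT : 0 ≤ T)
    (x : C(Set.Icc 0 T, E)) (s : ℝ) : ‖Set.IccExtend hT x s‖ ≤ ‖x‖ := x.norm_coe_le_norm _

/-- `N` is dominated by integration: `‖(N x)(t)‖² ≤ M ∫₀ᵗ ‖x‖²`. -/
def IsVolterraBounded (hT : 0 ≤ T) (N : C(Set.Icc 0 T, E) →L[ℝ] C(Set.Icc 0 T, E)) (M : ℝ) :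
    Prop :=
  ∀ (x : C(Set.Icc 0 T, E)) (t : Set.Icc 0 T),
    ‖N x t‖ ^ 2 ≤ M * ∫ s in (0 : ℝ)..t, ‖Set.IccExtend hT x s‖ ^ 2

theorem IsVolterraBounded.add {hT : 0 ≤ T} {N₁ N₂ : C(Set.Icc 0 T, E) →L[ℝ] C(Set.Icc 0 T, E)}
    {M₁ M₂ : ℝ} (h₁ : IsVolterraBounded hT N₁ M₁) (h₂ : IsVolterraBounded hT N₂ M₂) :
    IsVolterraBounded hT (N₁ + N₂) (2 * (M₁ + M₂)) := by
  intro x t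
  have h3 : ‖(N₁ + N₂) x t‖ ≤ ‖N₁ x t‖ + ‖N₂ x t‖ := norm_add_le (N₁ x t) (N₂ x t)
  have h4 := pow_le_pow_left₀ (norm_nonneg _) h3 2
  nlinarith [h₁ x t, h₂ x t, sq_nonneg (‖N₁ x t‖ - ‖N₂ x t‖)]

theorem IsVolterraBounded.smul {hT : 0 ≤ T} {N : C(Set.Icc 0 T, E) →L[ℝ] C(Set.Icc 0 T, E)}
    {M : ℝ} (h : IsVolterraBounded hT N M) (c : ℝ) : IsVolterraBounded hT (c • N) (c ^ 2 * M) := by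
  intro x t
  have h3 : ‖(c • N) x t‖ = |c| * ‖N x t‖ := by
    rw [← Real.norm_eq_abs]; exact norm_smul c (N x t)
  rw [h3, mul_pow, sq_abs, mul_assoc]
  exact mul_le_mul_of_nonneg_left (h x t) (sq_nonneg c)

/-- Iterating the integral bound integrates over the simplex `s₁ ≤ ⋯ ≤ sₙ ≤ t`, whose volume is
`tⁿ/n!`. -/
theorem IsVolterraBounded.pow_apply {hT : 0 ≤ T}
    {N : C(Set.Icc 0 T, E) →L[ℝ] C(Set.Icc 0 T, E)} {M : ℝ} (hM : 0 ≤ M)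
    (h : IsVolterraBounded hT N M) (n : ℕ) (x : C(Set.Icc 0 T, E)) (t : Set.Icc 0 T) :
    ‖(N ^ n) x t‖ ^ 2 ≤ M ^ n * ‖x‖ ^ 2 * ((t : ℝ) ^ n / n.factorial) := by
  induction n generalizing t with
  | zero =>
    have := x.norm_coe_le_norm t
    simpa using pow_le_pow_left₀ (norm_nonneg _) this 2
  | succ n ih =>
    have h1 := h ((N ^ n) x) t
    have h2 : ∫ s in (0 : ℝ)..t, ‖Set.IccExtend hT ((N ^ n) x) s‖ ^ 2
        ≤ ∫ s in (0 : ℝ)..t, M ^ n * ‖x‖ ^ 2 * (s ^ n / n.factorial) := by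
      refine intervalIntegral.integral_mono_on t.2.1 ?_ ?_ ?_
      · exact ((continuous_IccExtend hT _).norm.pow 2).intervalIntegrable _ _
      · exact (by fun_prop : Continuous fun s : ℝ =>
          M ^ n * ‖x‖ ^ 2 * (s ^ n / n.factorial)).intervalIntegrable _ _
      · intro s hs
        have hs' : s ∈ Set.Icc 0 T := ⟨hs.1, hs.2.trans t.2.2⟩
        rw [Set.IccExtend_of_mem hT _ hs']
        exact ih ⟨s, hs'⟩
    have h3 : ∫ s in (0 : ℝ)..t, M ^ n * ‖x‖ ^ 2 * (s ^ n / n.factorial)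
        = M ^ n * ‖x‖ ^ 2 * ((t : ℝ) ^ (n + 1) / (n + 1).factorial) := by
      rw [intervalIntegral.integral_const_mul, intervalIntegral.integral_div, integral_pow,
        Nat.factorial_succ]
      have : (n.factorial : ℝ) ≠ 0 := by positivity
      push_cast
      field_simp
      simp
    have h4 : (N ^ (n + 1)) x = N ((N ^ n) x) := by rw [pow_succ']; rfl
    rw [h4]
    calc _ ≤ _ := h1
      _ ≤ M * _ := mul_le_mul_of_nonneg_left (h2.trans_eq h3) hM
      _ = _ := by ring

/-- Some power of `N` is a contraction, so `1 - Nⁿ` is invertible by the Neumann series. It factors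
into `1 - N` and a commuting geometric sum, so `1 - N` is invertible too. No smallness of `N` itself
is needed. -/
theorem IsVolterraBounded.isUnit_one_sub [CompleteSpace E] {hT : 0 ≤ T}
    {N : C(Set.Icc 0 T, E) →L[ℝ] C(Set.Icc 0 T, E)} {M : ℝ} (hM : 0 ≤ M)
    (h : IsVolterraBounded hT N M) : IsUnit (1 - N) := by
  have hlim := FloorSemiring.tendsto_pow_div_factorial_atTop (M * T)
  -- The estimates are for squared norms: `1/4` here becomes `‖Nⁿ‖ ≤ 1/2`.
  obtain ⟨n, hn⟩ := (hlim.eventually (gt_mem_nhds (show (0 : ℝ) < 1 / 4 by norm_num))).exists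
  have hnorm : ‖N ^ n‖ ≤ 1 / 2 := by
    refine ContinuousLinearMap.opNorm_le_bound _ (by norm_num) fun x => ?_
    rw [ContinuousMap.norm_le _ (by positivity)]
    intro t
    have h1 := h.pow_apply hM n x t
    have h2 : M ^ n * ‖x‖ ^ 2 * ((t : ℝ) ^ n / n.factorial) ≤ (1 / 2 * ‖x‖) ^ 2 := by
      have h3 : (t : ℝ) ^ n ≤ T ^ n := pow_le_pow_left₀ t.2.1 t.2.2 n
      calc M ^ n * ‖x‖ ^ 2 * ((t : ℝ) ^ n / n.factorial)
          ≤ M ^ n * ‖x‖ ^ 2 * (T ^ n / n.factorial) := by gcongr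
        _ = (M * T) ^ n / n.factorial * ‖x‖ ^ 2 := by rw [mul_pow]; ring
        _ ≤ 1 / 4 * ‖x‖ ^ 2 := by gcongr
        _ = _ := by ring
    exact abs_le_of_sq_le_sq' (h1.trans h2) (by positivity) |>.2
  have hu : IsUnit (1 - N ^ n) := isUnit_one_sub_of_norm_lt_one
    (R := C(Set.Icc 0 T, E) →L[ℝ] C(Set.Icc 0 T, E)) (hnorm.trans_lt (by norm_num))
  have hc : Commute (1 - N) (∑ i ∈ Finset.range n, N ^ i) :=
    (Commute.sum_right _ _ _ fun i _ =>
      ((Commute.one_left _).sub_left (Commute.self_pow N i)))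
  rw [← mul_neg_geom_sum, hc.isUnit_mul_iff] at hu
  exact hu.1

/-- The Volterra operator `(f, x) ↦ (t ↦ ∫₀ᵗ f(s) B(s) x(s) ds)`. -/
def volterraAux (hT : 0 ≤ T) (B : ℝ → E →L[ℝ] E) (hB : Continuous B) (f : Control T)
    (x : C(Set.Icc 0 T, E)) : C(Set.Icc 0 T, E) where
  toFun t := ∫ s in (0 : ℝ)..t, f s • B s (Set.IccExtend hT x s)
  continuous_toFun := by
    have h := intervalIntegral.continuousOn_primitive_interval' (μ := volume) (a := (0 : ℝ))
      (b₁ := 0) (b₂ := T) (f := fun s => f s • B s (Set.IccExtend hT x s))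
      (f.intervalIntegrable_smul (hB.clm_apply (continuous_IccExtend hT x)) ⟨hT, le_rfl⟩)
      (by simp)
    rw [Set.uIcc_of_le hT] at h
    exact continuousOn_iff_continuous_domRestrict.1 h

theorem volterraAux_apply (hT : 0 ≤ T) {B : ℝ → E →L[ℝ] E} (hB : Continuous B) (f : Control T)
    (x : C(Set.Icc 0 T, E)) (t : Set.Icc 0 T) :
    volterraAux hT B hB f x t = ∫ s in (0 : ℝ)..t, f s • B s (Set.IccExtend hT x s) := rfl

theorem exists_opNorm_bound (hT : 0 ≤ T) {B : ℝ → E →L[ℝ] E} (hB : Continuous B) :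
    ∃ b, 0 ≤ b ∧ ∀ s ∈ Set.Icc 0 T, ‖B s‖ ≤ b := by
  obtain ⟨b, hb⟩ := isCompact_Icc.exists_bound_of_continuousOn (s := Set.Icc 0 T) hB.continuousOn
  exact ⟨b, (norm_nonneg _).trans (hb 0 ⟨le_rfl, hT⟩), hb⟩

/-- The control has no pointwise bound, so Cauchy-Schwarz moves it into its `L²` norm. This is why
Volterra domination is phrased with squares. -/
theorem norm_volterraAux_sq_le (hT : 0 ≤ T) {B : ℝ → E →L[ℝ] E} (hB : Continuous B) {b : ℝ}
    (hb : ∀ s ∈ Set.Icc 0 T, ‖B s‖ ≤ b) (f : Control T) (x : C(Set.Icc 0 T, E))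
    (t : Set.Icc 0 T) :
    ‖volterraAux hT B hB f x t‖ ^ 2
      ≤ (b * ‖f‖) ^ 2 * ∫ s in (0 : ℝ)..t, ‖Set.IccExtend hT x s‖ ^ 2 := by
  have hc := hB.clm_apply (continuous_IccExtend hT x)
  refine (f.norm_integral_smul_sq_le hc t.2).trans ?_
  have h : ∫ s in (0 : ℝ)..t, ‖B s (Set.IccExtend hT x s)‖ ^ 2
      ≤ ∫ s in (0 : ℝ)..t, b ^ 2 * ‖Set.IccExtend hT x s‖ ^ 2 := by
    refine intervalIntegral.integral_mono_on t.2.1 ((hc.norm.pow 2).intervalIntegrable _ _)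
      ((continuous_const.mul
        ((continuous_IccExtend hT x).norm.pow 2)).intervalIntegrable _ _) fun s hs => ?_
    rw [← mul_pow]
    have := hb s ⟨hs.1, hs.2.trans t.2.2⟩
    exact pow_le_pow_left₀ (norm_nonneg _) ((B s).le_of_opNorm_le this _) 2
  rw [intervalIntegral.integral_const_mul] at h
  calc _ ≤ ‖f‖ ^ 2 * _ := mul_le_mul_of_nonneg_left h (sq_nonneg _)
    _ = _ := by ring

theorem norm_volterraAux_le (hT : 0 ≤ T) {B : ℝ → E →L[ℝ] E} (hB : Continuous B) {b : ℝ}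
    (hb0 : 0 ≤ b) (hb : ∀ s ∈ Set.Icc 0 T, ‖B s‖ ≤ b) (f : Control T) (x : C(Set.Icc 0 T, E)) :
    ‖volterraAux hT B hB f x‖ ≤ b * √T * ‖f‖ * ‖x‖ := by
  rw [ContinuousMap.norm_le _ (by positivity)]
  intro t
  have h : ∫ s in (0 : ℝ)..t, ‖Set.IccExtend hT x s‖ ^ 2 ≤ T * ‖x‖ ^ 2 := by
    calc ∫ s in (0 : ℝ)..t, ‖Set.IccExtend hT x s‖ ^ 2
        ≤ ∫ _s in (0 : ℝ)..t, ‖x‖ ^ 2 := by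
          refine intervalIntegral.integral_mono_on t.2.1
            (((continuous_IccExtend hT x).norm.pow 2).intervalIntegrable _ _)
            (by simp) fun s _ => ?_
          exact pow_le_pow_left₀ (norm_nonneg _) (norm_IccExtend_le hT x s) 2
      _ = t * ‖x‖ ^ 2 := by simp
      _ ≤ T * ‖x‖ ^ 2 := mul_le_mul_of_nonneg_right t.2.2 (sq_nonneg _)
  refine (abs_le_of_sq_le_sq' ((norm_volterraAux_sq_le hT hB hb f x t).trans ?_)
    (by positivity)).2
  calc _ ≤ (b * ‖f‖) ^ 2 * (T * ‖x‖ ^ 2) := mul_le_mul_of_nonneg_left h (sq_nonneg _)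
    _ = (b * √T * ‖f‖ * ‖x‖) ^ 2 := by
      rw [mul_pow, mul_pow, mul_pow, mul_pow, Real.sq_sqrt hT]; ring

/-- `volterraAux` as a bounded bilinear map. -/
def volterra (hT : 0 ≤ T) (B : ℝ → E →L[ℝ] E) (hB : Continuous B) :
    Control T →L[ℝ] C(Set.Icc 0 T, E) →L[ℝ] C(Set.Icc 0 T, E) :=
  LinearMap.mkContinuous₂
    (LinearMap.mk₂ ℝ (volterraAux hT B hB)
      (fun f g x => by
        ext t
        have hc := hB.clm_apply (continuous_IccExtend hT x)
        simp only [volterraAux_apply, ContinuousMap.add_apply]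
        rw [← intervalIntegral.integral_add (f.intervalIntegrable_smul hc t.2)
          (g.intervalIntegrable_smul hc t.2)]
        refine intervalIntegral.integral_congr_ae ?_
        have h : ∀ᵐ s ∂(volume.restrict (Set.Ioc 0 T)), (f + g) s = f s + g s := Lp.coeFn_add f g
        filter_upwards [Control.ae_of_ae (p := fun s y => y = f s + g s) h t.2] with s hs hst
        rw [hs hst, add_smul])
      (fun c f x => by
        ext t
        simp only [volterraAux_apply, ContinuousMap.smul_apply]
        rw [← intervalIntegral.integral_smul]
        refine intervalIntegral.integral_congr_ae ?_
        have h : ∀ᵐ s ∂(volume.restrict (Set.Ioc 0 T)), (c • f) s = c * f s := Lp.coeFn_smul c f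
        filter_upwards [Control.ae_of_ae (p := fun s y => y = c * f s) h t.2] with s hs hst
        rw [hs hst, mul_smul])
      (fun f x y => by
        ext t
        simp only [volterraAux_apply, ContinuousMap.add_apply]
        rw [← intervalIntegral.integral_add
          (f.intervalIntegrable_smul (hB.clm_apply (continuous_IccExtend hT x)) t.2)
          (f.intervalIntegrable_smul (hB.clm_apply (continuous_IccExtend hT y)) t.2)]
        refine intervalIntegral.integral_congr fun s _ => ?_
        simp [Set.IccExtend, smul_add])
      (fun c f x => by
        ext t
        simp only [volterraAux_apply, ContinuousMap.smul_apply]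
        rw [← intervalIntegral.integral_smul]
        refine intervalIntegral.integral_congr fun s _ => ?_
        simp [Set.IccExtend, smul_comm c (f s)]))
    ((exists_opNorm_bound hT hB).choose * √T)
    (fun f x => norm_volterraAux_le hT hB (exists_opNorm_bound hT hB).choose_spec.1
      (exists_opNorm_bound hT hB).choose_spec.2 f x)

theorem volterra_apply (hT : 0 ≤ T) {B : ℝ → E →L[ℝ] E} (hB : Continuous B) (f : Control T)
    (x : C(Set.Icc 0 T, E)) (t : Set.Icc 0 T) :
    volterra hT B hB f x t = ∫ s in (0 : ℝ)..t, f s • B s (Set.IccExtend hT x s) := rfl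

theorem isVolterraBounded_volterra (hT : 0 ≤ T) {B : ℝ → E →L[ℝ] E} (hB : Continuous B)
    (f : Control T) : ∃ M, 0 ≤ M ∧ IsVolterraBounded hT (volterra hT B hB f) M := by
  obtain ⟨b, -, hb⟩ := exists_opNorm_bound hT hB
  exact ⟨(b * ‖f‖) ^ 2, sq_nonneg _, fun x t => norm_volterraAux_sq_le hT hB hb f x t⟩

/-- The constant control `1`. -/
def oneControl (T : ℝ) : Control T := Lp.const 2 (volume.restrict (Set.Ioc 0 T)) (1 : ℝ)

theorem ae_oneControl {t : ℝ} (ht : t ∈ Set.Icc 0 T) :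
    ∀ᵐ s, s ∈ Set.uIoc 0 t → oneControl T s = 1 := by
  refine Control.ae_of_ae (p := fun _ y => y = 1) ?_ ht
  exact Lp.coeFn_const ..

/-- The operator `x ↦ (t ↦ ∫₀ᵗ (ℓ A(s) + f(s) B(s)) x(s) ds)`, as a linear map in `(ℓ, f)`. -/
def generator (hT : 0 ≤ T) (A B : ℝ → E →L[ℝ] E) (hA : Continuous A) (hB : Continuous B) :
    (ℝ × Control T) →L[ℝ] C(Set.Icc 0 T, E) →L[ℝ] C(Set.Icc 0 T, E) :=
  (ContinuousLinearMap.fst ℝ ℝ (Control T)).smulRight (volterra hT A hA (oneControl T)) +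
    (volterra hT B hB).comp (ContinuousLinearMap.snd ℝ ℝ (Control T))

theorem generator_apply (hT : 0 ≤ T) {A B : ℝ → E →L[ℝ] E} (hA : Continuous A)
    (hB : Continuous B) (p : ℝ × Control T) (x : C(Set.Icc 0 T, E)) (t : Set.Icc 0 T) :
    generator hT A B hA hB p x t = ∫ s in (0 : ℝ)..t,
      (p.1 • A s (Set.IccExtend hT x s) + p.2 s • B s (Set.IccExtend hT x s)) := by
  have hcA := hA.clm_apply (continuous_IccExtend hT x)
  have hcB := hB.clm_apply (continuous_IccExtend hT x)
  have hiA : IntervalIntegrable (fun s => p.1 • A s (Set.IccExtend hT x s)) volume 0 t :=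
    (hcA.const_smul p.1).intervalIntegrable _ _
  rw [intervalIntegral.integral_add hiA (p.2.intervalIntegrable_smul hcB t.2), intervalIntegral.integral_smul]
  have h : ∫ s in (0 : ℝ)..t, A s (Set.IccExtend hT x s)
      = volterra hT A hA (oneControl T) x t := by
    rw [volterra_apply]
    refine intervalIntegral.integral_congr_ae ?_
    filter_upwards [ae_oneControl t.2] with s hs hst
    rw [hs hst, one_smul]
  rw [h, ← volterra_apply hT hB]
  rfl

theorem isUnit_one_sub_generator [CompleteSpace E] (hT : 0 ≤ T) {A B : ℝ → E →L[ℝ] E}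
    (hA : Continuous A) (hB : Continuous B) (p : ℝ × Control T) :
    IsUnit (1 - generator hT A B hA hB p) := by
  obtain ⟨M₁, hM₁, h₁⟩ := isVolterraBounded_volterra hT hA (oneControl T)
  obtain ⟨M₂, hM₂, h₂⟩ := isVolterraBounded_volterra hT hB p.2
  exact ((h₁.smul p.1).add h₂).isUnit_one_sub (by positivity)

/-- The solution of `x(t) = x₀ + ∫₀ᵗ (ℓ A(s) + f(s) B(s)) x(s) ds`. -/
def evolution (hT : 0 ≤ T) {A B : ℝ → E →L[ℝ] E} (hA : Continuous A) (hB : Continuous B)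
    (x₀ : E) (p : ℝ × Control T) : C(Set.Icc 0 T, E) :=
  Ring.inverse (1 - generator hT A B hA hB p) (ContinuousMap.const _ x₀)

/-- The integral equation is `(1 - K) x = x₀`. Invertibility of `1 - K` therefore yields existence
and uniqueness in one equivalence. -/
theorem eq_evolution_iff [CompleteSpace E] (hT : 0 ≤ T) {A B : ℝ → E →L[ℝ] E}
    (hA : Continuous A) (hB : Continuous B) (x₀ : E) (p : ℝ × Control T)
    (x : C(Set.Icc 0 T, E)) :
    x = evolution hT hA hB x₀ p ↔ ∀ t : Set.Icc 0 T, x t = x₀ + ∫ s in (0 : ℝ)..t,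
      (p.1 • A s (Set.IccExtend hT x s) + p.2 s • B s (Set.IccExtend hT x s)) := by
  have hu := isUnit_one_sub_generator hT hA hB p
  have h1 : x = evolution hT hA hB x₀ p ↔
      (1 - generator hT A B hA hB p) x = ContinuousMap.const _ x₀ := by
    constructor
    · rintro rfl
      change ((1 - generator hT A B hA hB p) * Ring.inverse (1 - generator hT A B hA hB p)) _ = _
      rw [Ring.mul_inverse_cancel _ hu]; rfl
    · intro h
      rw [evolution, ← h]
      change _ = (Ring.inverse (1 - generator hT A B hA hB p) * (1 - generator hT A B hA hB p)) _
      rw [Ring.inverse_mul_cancel _ hu]; rfl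
  rw [h1, ContinuousMap.ext_iff]
  refine forall_congr' fun t => ?_
  rw [← generator_apply hT hA hB]
  change x t - generator hT A B hA hB p x t = x₀ ↔ _
  rw [sub_eq_iff_eq_add]

end Volterra

/-! ### Calculus of resolvents -/

section Resolvent

variable {R P : Type*} [NormedRing R] [NormedAlgebra ℝ R] [CompleteSpace R]
  [NormedAddCommGroup P] [NormedSpace ℝ P]

/-- The derivative of inversion is `h ↦ -a⁻¹ h a⁻¹`, and the inner derivative is `-L`, so the signs
cancel. The shift by `p₀` makes the resolvent equal to `1` at `p₀`, so all factors disappear there.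
-/
theorem hasFDerivAt_inverse_one_sub (L : P →L[ℝ] R) (hL : ∀ p, IsUnit (1 - L p)) (p₀ p : P) :
    HasFDerivAt (fun p => Ring.inverse (1 - L (p - p₀)))
      ((ContinuousLinearMap.mulLeftRight ℝ R (Ring.inverse (1 - L (p - p₀)))
        (Ring.inverse (1 - L (p - p₀)))).comp L) p := by
  obtain ⟨u, hu⟩ := hL (p - p₀)
  have h1 : HasFDerivAt (fun p => 1 - L (p - p₀)) (-L) p := by
    simpa using ((L.hasFDerivAt (x := p - p₀)).comp p
      ((hasFDerivAt_id p).sub_const p₀)).const_sub 1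
  have h2 : HasFDerivAt Ring.inverse
      (-ContinuousLinearMap.mulLeftRight ℝ R ((u⁻¹ : Rˣ) : R) ((u⁻¹ : Rˣ) : R)) (1 - L (p - p₀)) :=
    hu ▸ hasFDerivAt_ringInverse u
  have h3 := h2.comp p h1
  rw [← hu, Ring.inverse_unit]
  refine h3.congr_fderiv ?_
  ext v
  simp

theorem contDiff_inverse_one_sub (L : P →L[ℝ] R) (hL : ∀ p, IsUnit (1 - L p))
    (Λ : R →L[ℝ] ℝ) (p₀ : P) {n : WithTop ℕ∞} :
    ContDiff ℝ n (fun p => Λ (Ring.inverse (1 - L (p - p₀)))) := by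
  refine Λ.contDiff.comp (contDiff_iff_contDiffAt.2 fun p => ?_)
  obtain ⟨u, hu⟩ := hL (p - p₀)
  have h1 : ContDiffAt ℝ n (fun p => 1 - L (p - p₀)) p :=
    (contDiff_const.sub (L.contDiff.comp (contDiff_id.sub contDiff_const))).contDiffAt
  exact ContDiffAt.comp p (hu ▸ contDiffAt_ringInverse ℝ u) h1

theorem fderiv_inverse_one_sub_apply (L : P →L[ℝ] R) (hL : ∀ p, IsUnit (1 - L p))
    (Λ : R →L[ℝ] ℝ) (p₀ : P) (p v : P) :
    fderiv ℝ (fun p => Λ (Ring.inverse (1 - L (p - p₀)))) p v =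
      Λ (Ring.inverse (1 - L (p - p₀)) * L v * Ring.inverse (1 - L (p - p₀))) := by
  rw [HasFDerivAt.fderiv (f := fun p => Λ (Ring.inverse (1 - L (p - p₀))))
    (Λ.hasFDerivAt.comp p (hasFDerivAt_inverse_one_sub L hL p₀ p))]
  simp

theorem fderiv_inverse_one_sub (L : P →L[ℝ] R) (hL : ∀ p, IsUnit (1 - L p))
    (Λ : R →L[ℝ] ℝ) (p₀ : P) (v : P) :
    fderiv ℝ (fun p => Λ (Ring.inverse (1 - L (p - p₀)))) p₀ v = Λ (L v) := by
  rw [fderiv_inverse_one_sub_apply L hL]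
  simp

/-- The second-order term of the Neumann series is `L(v)²`. Its polarization keeps both orders
because `R` is not commutative. -/
theorem fderiv_fderiv_inverse_one_sub (L : P →L[ℝ] R) (hL : ∀ p, IsUnit (1 - L p))
    (Λ : R →L[ℝ] ℝ) (p₀ : P) (a b : P) :
    fderiv ℝ (fderiv ℝ (fun p => Λ (Ring.inverse (1 - L (p - p₀))))) p₀ a b =
      Λ (L a * L b + L b * L a) := by
  have hd : DifferentiableAt ℝ (fderiv ℝ (fun p => Λ (Ring.inverse (1 - L (p - p₀))))) p₀ :=
    ((contDiff_inverse_one_sub L hL Λ p₀ (n := 2)).fderiv_right (m := 1) (by norm_num)).differentiable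
      (by norm_num) p₀
  -- Freezing the direction `b` reduces the second derivative to that of the real function `p ↦ Λ
  -- (R(p) L(b) R(p))`, with `R(p)` the resolvent.
  have h1 : fderiv ℝ (fderiv ℝ (fun p => Λ (Ring.inverse (1 - L (p - p₀))))) p₀ a b =
      fderiv ℝ (fun p => fderiv ℝ (fun p => Λ (Ring.inverse (1 - L (p - p₀)))) p b) p₀ a := by
    rw [fderiv_clm_apply hd (differentiableAt_const b)]
    simp
  rw [h1]
  simp_rw [fderiv_inverse_one_sub_apply L hL]
  have hG := hasFDerivAt_inverse_one_sub L hL p₀ p₀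
  have h2 := Λ.hasFDerivAt.comp p₀ ((hG.mul_const' (L b)).mul' hG)
  rw [HasFDerivAt.fderiv (f := fun p => Λ (Ring.inverse (1 - L (p - p₀)) * L b *
    Ring.inverse (1 - L (p - p₀)))) h2]
  simp [add_comm]

end Resolvent

/-! ### The second derivative test on finite-dimensional subspaces -/

/-- Compactness of the unit sphere of `E` upgrades pointwise negativity to a uniform gap. In
infinite dimension a negative definite form need not have such a gap. -/
theorem exists_neg_bound_of_finiteDimensional {V : Type*} [NormedAddCommGroup V] [NormedSpace ℝ V]
    (Q : V →L[ℝ] V →L[ℝ] ℝ) (hQ : ∀ v, v ≠ 0 → Q v v < 0) (E : Submodule ℝ V)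
    [FiniteDimensional ℝ E] : ∃ m > 0, ∀ v ∈ E, Q v v ≤ -m * ‖v‖ ^ 2 := by
  have : ProperSpace E := FiniteDimensional.proper ℝ E
  obtain ⟨m, hm, hb⟩ : ∃ m > 0, ∀ v : E, ‖v‖ = 1 → Q v v ≤ -m := by
    -- An empty sphere means that `E` is trivial, and then any positive `m` works.
    rcases (Metric.sphere (0 : E) 1).eq_empty_or_nonempty with h | h
    · refine ⟨1, one_pos, fun v hv => ?_⟩
      have : v ∈ Metric.sphere (0 : E) 1 := by simpa using hv
      simp [h] at this
    · have hc : Continuous fun v : E => Q v v := by fun_prop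
      obtain ⟨w, hw, hmax⟩ := (isCompact_sphere (0 : E) 1).exists_isMaxOn h hc.continuousOn
      have hw1 : ‖w‖ = 1 := by simpa using hw
      have hw0 : (w : V) ≠ 0 := by
        rintro h0
        have : w = 0 := by exact_mod_cast h0
        simp [this] at hw1
      refine ⟨-Q w w, neg_pos.2 (hQ w hw0), fun v hv => ?_⟩
      rw [neg_neg]
      exact hmax (by simpa using hv : v ∈ Metric.sphere (0 : E) 1)
  refine ⟨m, hm, fun v hv => ?_⟩
  rcases eq_or_ne v 0 with rfl | h0
  · simp
  have hn : 0 < ‖v‖ := norm_pos_iff.2 h0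
  have h1 := hb ⟨‖v‖⁻¹ • v, E.smul_mem _ hv⟩ (by
    change ‖‖v‖⁻¹ • v‖ = 1
    rw [norm_smul, norm_inv, norm_norm, inv_mul_cancel₀ hn.ne'])
  simp only [map_smul, _root_.smul_apply, smul_eq_mul] at h1
  have h2 : Q v v = ‖v‖ ^ 2 * (‖v‖⁻¹ * (‖v‖⁻¹ * Q v v)) := by field_simp
  rw [h2]
  nlinarith [sq_nonneg ‖v‖]

/-- Along the segment `x + tv` the derivative is `t Q(v, v)` up to an error of at most `(m/2) t
‖v‖²`, while `Q(v, v) ≤ -m ‖v‖²`. So `f` strictly decreases on the whole segment. -/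
theorem eventually_lt_of_hessian_neg {V : Type*} [NormedAddCommGroup V] [NormedSpace ℝ V]
    {f : V → ℝ} {x : V} (hf : ContDiffAt ℝ 2 f x) (h0 : fderiv ℝ f x = 0)
    (hneg : ∀ v, v ≠ 0 → fderiv ℝ (fderiv ℝ f) x v v < 0) (E : Submodule ℝ V)
    [FiniteDimensional ℝ E] :
    ∀ᶠ v : E in nhds 0, v ≠ 0 → f (x + v) < f x := by
  obtain ⟨m, hm, hb⟩ := exists_neg_bound_of_finiteDimensional _ hneg E
  have hdiff : ∀ᶠ y in nhds x, DifferentiableAt ℝ f y :=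
    (hf.eventually (by simp)).mono fun y hy => hy.differentiableAt (by norm_num)
  have hd2 : DifferentiableAt ℝ (fderiv ℝ f) x :=
    (hf.fderiv_right (m := 1) (by norm_num)).differentiableAt (by norm_num)
  have ho := hd2.hasFDerivAt.isLittleO.def (half_pos hm)
  obtain ⟨δ, hδ, hball⟩ := Metric.eventually_nhds_iff_ball.1 (hdiff.and ho)
  refine Metric.eventually_nhds_iff_ball.2 ⟨δ, hδ, fun v hv hv0 => ?_⟩
  have hvn : ‖(v : V)‖ < δ := by simpa using hv
  have hvpos : 0 < ‖(v : V)‖ := norm_pos_iff.2 (by exact_mod_cast hv0)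
  have hmem : ∀ t ∈ Set.Icc (0 : ℝ) 1, x + t • (v : V) ∈ Metric.ball x δ := by
    intro t ht
    rw [mem_ball_iff_norm, add_sub_cancel_left, norm_smul, Real.norm_of_nonneg ht.1]
    nlinarith [ht.2]
  have hder : ∀ t ∈ Set.Icc (0 : ℝ) 1, HasDerivAt (fun t : ℝ => f (x + t • (v : V)))
      (fderiv ℝ f (x + t • (v : V)) v) t := by
    intro t ht
    have h1 : HasDerivAt (fun t : ℝ => x + t • (v : V)) (v : V) t := by
      simpa using ((hasDerivAt_id t).smul_const (v : V)).const_add x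
    exact (hball _ (hmem t ht)).1.hasFDerivAt.comp_hasDerivAt t h1
  have hanti : StrictAntiOn (fun t : ℝ => f (x + t • (v : V))) (Set.Icc 0 1) := by
    refine strictAntiOn_of_deriv_neg (convex_Icc 0 1)
      (fun t ht => (hder t ht).continuousAt.continuousWithinAt) fun t ht => ?_
    rw [interior_Icc] at ht
    have ht' : t ∈ Set.Icc (0 : ℝ) 1 := ⟨ht.1.le, ht.2.le⟩
    rw [(hder t ht').deriv]
    have h2 := (hball _ (hmem t ht')).2
    rw [h0, sub_zero, add_sub_cancel_left, norm_smul, Real.norm_of_nonneg ht.1.le] at h2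
    have h3 := (fderiv ℝ f (x + t • (v : V)) -
      fderiv ℝ (fderiv ℝ f) x (t • (v : V))).le_of_opNorm_le h2 (v : V)
    have h4 := (le_abs_self _).trans h3
    have h5 := hb v v.2
    simp only [_root_.sub_apply, map_smul, _root_.smul_apply,
      smul_eq_mul] at h4
    have h6 : t * fderiv ℝ (fderiv ℝ f) x v v ≤ t * (-m * ‖(v : V)‖ ^ 2) :=
      mul_le_mul_of_nonneg_left h5 ht.1.le
    have h7 : 0 < m / 2 * t * ‖(v : V)‖ ^ 2 := by have := ht.1; positivity
    nlinarith
  have := hanti (Set.left_mem_Icc.2 zero_le_one) (Set.right_mem_Icc.2 zero_le_one) one_pos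
  simpa using this

/-! ### The product rule for primitives of integrable functions -/

/-- Primitives of integrable functions are absolutely continuous, so the product rule holds almost
everywhere and integrates back. Continuity of `x` and `y` is not available for controls. -/
theorem integral_mul_primitive_add {x y : ℝ → ℝ} {t : ℝ} (hx : IntervalIntegrable x volume 0 t)
    (hy : IntervalIntegrable y volume 0 t) :
    ∫ s in (0 : ℝ)..t, (x s * (∫ v in (0 : ℝ)..s, y v) + (∫ v in (0 : ℝ)..s, x v) * y s) =
      (∫ v in (0 : ℝ)..t, x v) * ∫ v in (0 : ℝ)..t, y v := by
  have h := AbsolutelyContinuousOnInterval.integral_deriv_mul_eq_sub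
    (hx.absolutelyContinuousOnInterval_intervalIntegral (c := 0) (by simp))
    (hy.absolutelyContinuousOnInterval_intervalIntegral (c := 0) (by simp))
  simp only [intervalIntegral.integral_same, mul_zero, sub_zero] at h
  rw [← h]
  refine intervalIntegral.integral_congr_ae ?_
  filter_upwards [hx.ae_hasDerivAt_integral, hy.ae_hasDerivAt_integral] with s h1 h2 hs
  have hs' := Set.uIoc_subset_uIcc hs
  rw [(h1 hs' 0 (by simp)).deriv, (h2 hs' 0 (by simp)).deriv]

theorem intervalIntegrable_mono_zero {E : Type*} [NormedAddCommGroup E] {x : ℝ → E} {t s : ℝ}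
    (hx : IntervalIntegrable x volume 0 t) (hs : s ∈ Set.uIcc 0 t) :
    IntervalIntegrable x volume 0 s :=
  hx.mono_set (Set.uIcc_subset_uIcc_left hs)

theorem continuousOn_primitive_zero {E : Type*} [NormedAddCommGroup E] [NormedSpace ℝ E]
    {x : ℝ → E} {t : ℝ} (hx : IntervalIntegrable x volume 0 t) :
    ContinuousOn (fun s => ∫ v in (0 : ℝ)..s, x v) (Set.uIcc 0 t) :=
  intervalIntegral.continuousOn_primitive_interval' hx (by simp)

theorem re_intervalIntegral {x : ℝ → ℂ} {a b : ℝ} (hx : IntervalIntegrable x volume a b) :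
    (∫ s in a..b, x s).re = ∫ s in a..b, (x s).re :=
  (reCLM.intervalIntegral_comp_comm hx).symm

theorem im_intervalIntegral {x : ℝ → ℂ} {a b : ℝ} (hx : IntervalIntegrable x volume a b) :
    (∫ s in a..b, x s).im = ∫ s in a..b, (x s).im :=
  (imCLM.intervalIntegral_comp_comm hx).symm

theorem integral_mul_primitive_add_complex {x y : ℝ → ℂ} {t : ℝ}
    (hx : IntervalIntegrable x volume 0 t) (hy : IntervalIntegrable y volume 0 t) :
    ∫ s in (0 : ℝ)..t, (x s * (∫ v in (0 : ℝ)..s, y v) + (∫ v in (0 : ℝ)..s, x v) * y s) =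
      (∫ v in (0 : ℝ)..t, x v) * ∫ v in (0 : ℝ)..t, y v := by
  have hint : IntervalIntegrable (fun s => x s * (∫ v in (0 : ℝ)..s, y v) +
      (∫ v in (0 : ℝ)..s, x v) * y s) volume 0 t :=
    (hx.mul_continuousOn (continuousOn_primitive_zero hy)).add
      (hy.continuousOn_mul (continuousOn_primitive_zero hx))
  have hre : ∀ {z : ℝ → ℂ}, IntervalIntegrable z volume 0 t →
      IntervalIntegrable (fun s => (z s).re) volume 0 t := fun h => ⟨h.1.re, h.2.re⟩
  have him : ∀ {z : ℝ → ℂ}, IntervalIntegrable z volume 0 t →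
      IntervalIntegrable (fun s => (z s).im) volume 0 t := fun h => ⟨h.1.im, h.2.im⟩
  have hr : ∀ {u v : ℝ → ℝ}, IntervalIntegrable u volume 0 t → IntervalIntegrable v volume 0 t →
      IntervalIntegrable (fun s => u s * (∫ w in (0 : ℝ)..s, v w) +
        (∫ w in (0 : ℝ)..s, u w) * v s) volume 0 t := fun hu hv =>
    (hu.mul_continuousOn (continuousOn_primitive_zero hv)).add
      (hv.continuousOn_mul (continuousOn_primitive_zero hu))
  apply Complex.ext
  · rw [re_intervalIntegral hint, mul_re, re_intervalIntegral hx, re_intervalIntegral hy,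
      im_intervalIntegral hx, im_intervalIntegral hy,
      ← integral_mul_primitive_add (hre hx) (hre hy), ← integral_mul_primitive_add (him hx) (him hy),
      ← intervalIntegral.integral_sub (hr (hre hx) (hre hy)) (hr (him hx) (him hy))]
    refine intervalIntegral.integral_congr fun s hs => ?_
    have h1 := intervalIntegrable_mono_zero hx hs
    have h2 := intervalIntegrable_mono_zero hy hs
    simp only [add_re, mul_re, re_intervalIntegral h1, re_intervalIntegral h2,
      im_intervalIntegral h1, im_intervalIntegral h2]
    ring
  · rw [im_intervalIntegral hint, mul_im, re_intervalIntegral hx, re_intervalIntegral hy,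
      im_intervalIntegral hx, im_intervalIntegral hy,
      ← integral_mul_primitive_add (hre hx) (him hy), ← integral_mul_primitive_add (him hx) (hre hy),
      ← intervalIntegral.integral_add (hr (hre hx) (him hy)) (hr (him hx) (hre hy))]
    refine intervalIntegral.integral_congr fun s hs => ?_
    have h1 := intervalIntegrable_mono_zero hx hs
    have h2 := intervalIntegrable_mono_zero hy hs
    simp only [add_im, mul_im, re_intervalIntegral h1, re_intervalIntegral h2,
      im_intervalIntegral h1, im_intervalIntegral h2]
    ring

/-! ### The Fourier series of `|sin|` -/

theorem fourierCoeffOn_sin (n : ℤ) :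
    fourierCoeffOn Real.pi_pos (fun x : ℝ => (Real.sin x : ℂ)) n =
      2 / (Real.pi * (1 - 4 * (n : ℂ) ^ 2)) := by
  have hne : (1 - 4 * (n : ℂ) ^ 2) ≠ 0 := by
    -- Divisibility by four: `1` is not a multiple of `4`.
    have h : (1 - 4 * n ^ 2 : ℤ) ≠ 0 := by omega
    exact_mod_cast h
  have hπ : (Real.pi : ℂ) ≠ 0 := by exact_mod_cast Real.pi_ne_zero
  rw [fourierCoeffOn_eq_integral]
  have hder : ∀ x : ℝ, HasDerivAt (fun x : ℝ => exp (-2 * I * n * x) *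
      (-(cos x + 2 * I * n * sin x) / (1 - 4 * (n : ℂ) ^ 2)))
      (exp (-2 * I * n * x) * sin x) x := by
    intro x
    have h1 : HasDerivAt (fun x : ℂ => exp (-2 * I * n * x) *
      (-(cos x + 2 * I * n * sin x) / (1 - 4 * (n : ℂ) ^ 2)))
      (exp (-2 * I * n * x) * sin x) (x : ℂ) := by
      have he : HasDerivAt (fun x : ℂ => exp (-2 * I * n * x))
          (exp (-2 * I * n * x) * (-2 * I * n)) (x : ℂ) := by
        simpa using (((hasDerivAt_id (x : ℂ)).const_mul (-2 * I * n)).cexp)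
      have hb := (((Complex.hasDerivAt_cos (x : ℂ)).add
        ((Complex.hasDerivAt_sin (x : ℂ)).const_mul (2 * I * n))).neg.div_const
          (1 - 4 * (n : ℂ) ^ 2))
      refine (he.mul hb).congr_deriv ?_
      simp only [Pi.add_apply, Pi.neg_apply]
      have hD : sin (x : ℂ) * (1 + 4 * I ^ 2 * (n : ℂ) ^ 2) / (1 - 4 * (n : ℂ) ^ 2) = sin x := by
        rw [I_sq, div_eq_iff hne]
        ring
      linear_combination exp (-2 * I * n * x) * hD
    exact h1.comp_ofReal
  have hint : ∫ x in (0 : ℝ)..Real.pi, fourier (-n) (x : AddCircle (Real.pi - 0)) •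
      (Real.sin x : ℂ) = 2 / (1 - 4 * (n : ℂ) ^ 2) := by
    have h1 : ∀ x : ℝ, fourier (-n) (x : AddCircle (Real.pi - 0)) • (Real.sin x : ℂ) =
        exp (-2 * I * n * x) * sin x := by
      intro x
      rw [fourier_coe_apply, smul_eq_mul, ofReal_sin]
      congr 2
      push_cast
      rw [sub_zero]
      field_simp
    simp_rw [h1]
    rw [intervalIntegral.integral_eq_sub_of_hasDerivAt (fun x _ => hder x)
      ((by fun_prop : Continuous fun x : ℝ => exp (-2 * I * n * x) * sin x).intervalIntegrable _ _)]
    have he : exp (-2 * I * n * (Real.pi : ℝ)) = 1 := by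
      rw [exp_eq_one_iff]
      exact ⟨-n, by push_cast; ring⟩
    rw [he, Complex.cos_pi, Complex.sin_pi]
    simp
    ring
  rw [hint, sub_zero, real_smul]
  push_cast
  field_simp

theorem norm_sinCoeff_le (k : ℕ) :
    ‖4 / (Real.pi * (4 * ((k : ℝ) + 1) ^ 2 - 1))‖ ≤ 4 * (1 / ((k : ℝ) + 1) ^ 2) := by
  have h1 : (0 : ℝ) < ((k : ℝ) + 1) ^ 2 := by positivity
  have h2 : (1 : ℝ) ≤ ((k : ℝ) + 1) ^ 2 := by nlinarith [(Nat.cast_nonneg k : (0 : ℝ) ≤ k)]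
  have h3 : ((k : ℝ) + 1) ^ 2 ≤ Real.pi * (4 * ((k : ℝ) + 1) ^ 2 - 1) := by
    nlinarith [Real.pi_gt_three]
  rw [Real.norm_of_nonneg (div_nonneg (by norm_num) (h1.le.trans h3)), mul_one_div]
  exact div_le_div_of_nonneg_left (by norm_num) h1 h3

theorem sinCoeff_pos (k : ℕ) : 0 < 4 / (Real.pi * (4 * ((k : ℝ) + 1) ^ 2 - 1)) := by
  have : (0 : ℝ) < 4 * ((k : ℝ) + 1) ^ 2 - 1 := by
    nlinarith [(Nat.cast_nonneg k : (0 : ℝ) ≤ k)]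
  have := Real.pi_pos
  positivity

theorem summable_sinCoeff : Summable fun k : ℕ => 4 / (Real.pi * (4 * ((k : ℝ) + 1) ^ 2 - 1)) := by
  refine Summable.of_norm_bounded (g := fun k : ℕ => 4 * (1 / ((k : ℝ) + 1) ^ 2)) ?_
    norm_sinCoeff_le
  have h := (summable_nat_add_iff 1).2 (Real.summable_one_div_nat_pow.2 one_lt_two)
  simpa using h.mul_left 4

/-- The `π`-periodic extension of `sin` from `[0, π)` is `|sin|`. It is continuous with summable
coefficients, so its Fourier series converges pointwise, and the modes `±n` pair up to cosines. The
sign is arranged so that all coefficients are positive. -/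
theorem hasSum_sin {x : ℝ} (hx : x ∈ Set.Icc 0 Real.pi) :
    HasSum (fun k : ℕ => 4 / (Real.pi * (4 * ((k : ℝ) + 1) ^ 2 - 1)) *
      Real.cos (2 * ((k : ℝ) + 1) * x)) (2 / Real.pi - Real.sin x) := by
  have : Fact (0 < Real.pi) := ⟨Real.pi_pos⟩
  let g : ℝ → ℂ := fun x => (Real.sin x : ℂ)
  have hcont : Continuous (AddCircle.liftIco Real.pi 0 g) :=
    AddCircle.liftIco_zero_continuous (by simp [g]) (by fun_prop)
  let F : C(AddCircle Real.pi, ℂ) := ⟨_, hcont⟩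
  have hcoeff : ∀ n : ℤ, fourierCoeff F n = 2 / (Real.pi * (1 - 4 * (n : ℂ) ^ 2)) := by
    intro n
    have h := fourierCoeff_liftIco_eq (T := Real.pi) (a := 0) g n
    change fourierCoeff (AddCircle.liftIco Real.pi 0 g) n = _
    rw [h, ← fourierCoeffOn_sin]
    congr 1
    simp
  have hsymm : ∀ n : ℤ, fourierCoeff F (-n) = fourierCoeff F n := by
    intro n; rw [hcoeff, hcoeff]; simp
  have hcoeffk : ∀ k : ℕ, fourierCoeff F ((k + 1 : ℕ) : ℤ) =
      ((-(1 / 2) * (4 / (Real.pi * (4 * ((k : ℝ) + 1) ^ 2 - 1))) : ℝ) : ℂ) := by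
    intro k
    rw [hcoeff]
    have h1 : (Real.pi * (4 * ((k : ℝ) + 1) ^ 2 - 1) : ℝ) ≠ 0 := by
      have := sinCoeff_pos k
      intro h0; simp [h0] at this
    have h2 : (2 : ℂ) / (Real.pi * (1 - 4 * (((k + 1 : ℕ) : ℤ) : ℂ) ^ 2)) =
      ((2 / (Real.pi * (1 - 4 * ((k : ℝ) + 1) ^ 2)) : ℝ) : ℂ) := by push_cast; rfl
    rw [h2]
    congr 1
    have h3 : (Real.pi * (1 - 4 * ((k : ℝ) + 1) ^ 2) : ℝ) =
      -(Real.pi * (4 * ((k : ℝ) + 1) ^ 2 - 1)) := by ring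
    rw [h3, div_neg]
    ring
  have hsum : Summable (fourierCoeff F) := by
    have hs : Summable fun k : ℕ => fourierCoeff F (k : ℤ) := by
      rw [← summable_nat_add_iff 1]
      simp_rw [hcoeffk]
      exact ofRealCLM.summable (summable_sinCoeff.mul_left _)
    refine Summable.of_nat_of_neg hs ?_
    simp_rw [hsymm]
    exact hs
  have hpt := has_pointwise_sum_fourier_series_of_summable hsum (x : AddCircle Real.pi)
  have hFx : F (x : AddCircle Real.pi) = Real.sin x := by
    change AddCircle.liftIco Real.pi 0 g x = _
    -- The right endpoint lies outside the fundamental domain and is identified with `0`, where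
    -- `sin` has the same value.
    rcases hx.2.eq_or_lt with h | h
    · rw [h, AddCircle.coe_period, ← QuotientAddGroup.mk_zero,
        AddCircle.liftIco_zero_coe_apply ⟨le_rfl, Real.pi_pos⟩]
      simp [g]
    · rw [AddCircle.liftIco_zero_coe_apply ⟨hx.1, h⟩]
  have h1 := hpt.nat_add_neg
  -- Pairing `n` with `-n` counts the zero mode `c₀ = 2/π` twice, so the paired sum is `F(x) + c₀`.
  -- Removing the pair at `0` leaves `F(x) - c₀`.
  have h2 := (hasSum_nat_add_iff' 1).2 h1
  have h3 := Complex.hasSum_re h2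
  have hval : -(F (x : AddCircle Real.pi) + fourierCoeff F 0 • fourier 0 (x : AddCircle Real.pi) -
      ∑ i ∈ Finset.range 1, (fourierCoeff F (i : ℤ) • fourier (i : ℤ) (x : AddCircle Real.pi) +
        fourierCoeff F (-(i : ℤ)) • fourier (-(i : ℤ)) (x : AddCircle Real.pi))).re =
      2 / Real.pi - Real.sin x := by
    rw [hFx]
    simp only [Finset.range_one, Finset.sum_singleton, Nat.cast_zero, neg_zero, hcoeff,
      fourier_zero]
    have : (2 : ℂ) / (Real.pi * (1 - 4 * ((0 : ℤ) : ℂ) ^ 2)) = ((2 / Real.pi : ℝ) : ℂ) := by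
      push_cast; simp
    rw [this, smul_eq_mul, mul_one, ← ofReal_add, ← ofReal_add, ← ofReal_sub, ofReal_re]
    ring
  have h4 := h3.neg
  rw [hval] at h4
  refine (congrArg (fun g => HasSum g _) (funext fun k => ?_)).mp h4
  · rw [hsymm, hcoeffk, ← smul_add, fourier_coe_apply, fourier_coe_apply]
    have e1 : 2 * Real.pi * I * (((k + 1 : ℕ) : ℤ) : ℂ) * x / Real.pi =
        ((2 * ((k : ℝ) + 1) * x : ℝ) : ℂ) * I := by
      have hπ : (Real.pi : ℂ) ≠ 0 := by exact_mod_cast Real.pi_ne_zero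
      push_cast; field_simp
    have e2 : 2 * Real.pi * I * ((-((k + 1 : ℕ) : ℤ) : ℤ) : ℂ) * x / Real.pi =
        -((2 * ((k : ℝ) + 1) * x : ℝ) : ℂ) * I := by
      have hπ : (Real.pi : ℂ) ≠ 0 := by exact_mod_cast Real.pi_ne_zero
      push_cast; field_simp
    rw [e1, e2, smul_eq_mul, re_ofReal_mul, ← Complex.two_cos, ← ofReal_cos]
    have : ((2 : ℂ) * ((Real.cos (2 * ((k : ℝ) + 1) * x) : ℝ) : ℂ)).re =
      2 * Real.cos (2 * ((k : ℝ) + 1) * x) := by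
      rw [← ofReal_ofNat, ← ofReal_mul, ofReal_re]
    rw [this]
    ring

/-! ### Completeness of the trigonometric system -/

/-- The hypotheses make every complex Fourier coefficient of period `T` vanish, since negative
indices follow from the parity of `cos` and `sin`. Parseval then gives `‖f‖ = 0`. -/
theorem Control.eq_zero_of_fourier {T : ℝ} (hT : 0 < T) (f : Control T)
    (h0 : ∫ t in (0 : ℝ)..T, f t = 0)
    (hc : ∀ k : ℕ, ∫ t in (0 : ℝ)..T, Real.cos (2 * Real.pi * ((k : ℝ) + 1) / T * t) * f t = 0)
    (hs : ∀ k : ℕ, ∫ t in (0 : ℝ)..T, Real.sin (2 * Real.pi * ((k : ℝ) + 1) / T * t) * f t = 0) :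
    f = 0 := by
  have hmem : MemLp (fun t => (f t : ℂ)) 2 (volume.restrict (Set.Ioc 0 T)) := (Lp.memLp f).ofReal
  have hpars := hasSum_sq_fourierCoeffOn hT hmem
  have hcz : ∀ k : ℤ, ∫ t in (0 : ℝ)..T, Real.cos (2 * Real.pi * k / T * t) * f t = 0 := by
    intro k
    rcases k with k | k
    · rcases k with _ | k
      · simpa using h0
      · simpa using hc k
    · refine Eq.trans ?_ (hc k)
      refine intervalIntegral.integral_congr fun t _ => ?_
      rw [← Real.cos_neg]
      congr 2
      push_cast
      ring
  have hsz : ∀ k : ℤ, ∫ t in (0 : ℝ)..T, Real.sin (2 * Real.pi * k / T * t) * f t = 0 := by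
    intro k
    rcases k with k | k
    · rcases k with _ | k
      · simp
      · simpa using hs k
    · refine Eq.trans ?_ (neg_eq_zero.2 (hs k))
      rw [← intervalIntegral.integral_neg]
      refine intervalIntegral.integral_congr fun t _ => ?_
      rw [← neg_mul, ← Real.sin_neg]
      congr 2
      push_cast
      ring
  have hzero : ∀ n : ℤ, fourierCoeffOn hT (fun t => (f t : ℂ)) n = 0 := by
    intro n
    rw [fourierCoeffOn_eq_integral]
    have h1 : ∀ t : ℝ, fourier (-n) (t : AddCircle (T - 0)) • (f t : ℂ) =
        ((Real.cos (2 * Real.pi * (-n : ℤ) / T * t) * f t : ℝ) : ℂ) +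
          ((Real.sin (2 * Real.pi * (-n : ℤ) / T * t) * f t : ℝ) : ℂ) * I := by
      intro t
      rw [fourier_coe_apply, sub_zero]
      have : 2 * Real.pi * I * ((-n : ℤ) : ℂ) * t / T =
          ((2 * Real.pi * (-n : ℤ) / T * t : ℝ) : ℂ) * I := by
        push_cast; ring
      rw [this, exp_mul_I, ← ofReal_cos, ← ofReal_sin, smul_eq_mul]
      push_cast
      ring
    have hi := f.intervalIntegrable hT.le
    have hic : IntervalIntegrable (fun t => Real.cos (2 * Real.pi * (-n : ℤ) / T * t) * f t)
        volume 0 T :=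
      hi.continuousOn_mul (by fun_prop)
    have his : IntervalIntegrable (fun t => Real.sin (2 * Real.pi * (-n : ℤ) / T * t) * f t)
        volume 0 T :=
      hi.continuousOn_mul (by fun_prop)
    have hic' : IntervalIntegrable (fun t => ((Real.cos (2 * Real.pi * (-n : ℤ) / T * t) * f t : ℝ) : ℂ))
        volume 0 T := ⟨hic.1.ofReal, hic.2.ofReal⟩
    have his' : IntervalIntegrable (fun t => ((Real.sin (2 * Real.pi * (-n : ℤ) / T * t) * f t : ℝ) : ℂ))
        volume 0 T := ⟨his.1.ofReal, his.2.ofReal⟩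
    simp_rw [h1]
    rw [intervalIntegral.integral_add hic' (his'.mul_const I),
      intervalIntegral.integral_mul_const, intervalIntegral.integral_ofReal,
      intervalIntegral.integral_ofReal, hcz, hsz]
    simp
  simp only [hzero, norm_zero, ne_eq, OfNat.ofNat_ne_zero, not_false_eq_true, zero_pow] at hpars
  have h2 := hpars.unique hasSum_zero
  rw [sub_zero, smul_eq_mul, mul_eq_zero, intervalIntegral.integral_of_le hT.le] at h2
  have h3 : ∫ t in Set.Ioc 0 T, ‖(f t : ℂ)‖ ^ 2 = ‖f‖ ^ 2 := by
    rw [← f.integral_sq_eq]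
    refine integral_congr_ae (Filter.Eventually.of_forall fun s => ?_)
    simp
  rw [h3] at h2
  rcases h2 with h2 | h2
  · exact absurd h2 (inv_ne_zero hT.ne')
  · exact norm_eq_zero.1 (pow_eq_zero_iff two_ne_zero |>.1 h2)

/-! ### Causal convolution forms -/

/-- The form `∫_{0<s<t<T} φ(t - s) x(s) y(t)`. -/
def causalForm (T : ℝ) (φ x y : ℝ → ℝ) : ℝ :=
  ∫ t in (0 : ℝ)..T, y t * ∫ s in (0 : ℝ)..t, φ (t - s) * x s

section Causal

variable {T : ℝ} {x y : ℝ → ℝ}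

/-- The addition formula separates `t` from `s`, so that the integral depends on `t` only through
primitives and smooth factors. -/
theorem integral_cos_sub_mul (ω : ℝ) {t : ℝ} (hx : IntervalIntegrable x volume 0 t) :
    ∫ s in (0 : ℝ)..t, Real.cos (ω * (t - s)) * x s =
      Real.cos (ω * t) * (∫ s in (0 : ℝ)..t, Real.cos (ω * s) * x s) +
        Real.sin (ω * t) * ∫ s in (0 : ℝ)..t, Real.sin (ω * s) * x s := by
  have h1 : IntervalIntegrable (fun s => Real.cos (ω * s) * x s) volume 0 t :=
    hx.continuousOn_mul (by fun_prop)
  have h2 : IntervalIntegrable (fun s => Real.sin (ω * s) * x s) volume 0 t :=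
    hx.continuousOn_mul (by fun_prop)
  rw [← intervalIntegral.integral_const_mul, ← intervalIntegral.integral_const_mul,
    ← intervalIntegral.integral_add (h1.const_mul _) (h2.const_mul _)]
  refine intervalIntegral.integral_congr fun s _ => ?_
  simp only [mul_sub, Real.cos_sub]
  ring

theorem integral_sin_sub_mul (ω : ℝ) {t : ℝ} (hx : IntervalIntegrable x volume 0 t) :
    ∫ s in (0 : ℝ)..t, Real.sin (ω * (t - s)) * x s =
      Real.sin (ω * t) * (∫ s in (0 : ℝ)..t, Real.cos (ω * s) * x s) -
        Real.cos (ω * t) * ∫ s in (0 : ℝ)..t, Real.sin (ω * s) * x s := by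
  have h1 : IntervalIntegrable (fun s => Real.cos (ω * s) * x s) volume 0 t :=
    hx.continuousOn_mul (by fun_prop)
  have h2 : IntervalIntegrable (fun s => Real.sin (ω * s) * x s) volume 0 t :=
    hx.continuousOn_mul (by fun_prop)
  rw [← intervalIntegral.integral_const_mul, ← intervalIntegral.integral_const_mul,
    ← intervalIntegral.integral_sub (h1.const_mul _) (h2.const_mul _)]
  refine intervalIntegral.integral_congr fun s _ => ?_
  simp only [mul_sub, Real.sin_sub]
  ring

theorem continuousOn_integral_cos_sub_mul (ω : ℝ) (hx : IntervalIntegrable x volume 0 T) :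
    ContinuousOn (fun t => ∫ s in (0 : ℝ)..t, Real.cos (ω * (t - s)) * x s) (Set.uIcc 0 T) := by
  have h1 : IntervalIntegrable (fun s => Real.cos (ω * s) * x s) volume 0 T :=
    hx.continuousOn_mul (by fun_prop)
  have h2 : IntervalIntegrable (fun s => Real.sin (ω * s) * x s) volume 0 T :=
    hx.continuousOn_mul (by fun_prop)
  have h3 : ContinuousOn (fun t => Real.cos (ω * t)) (Set.uIcc 0 T) := by fun_prop
  have h4 : ContinuousOn (fun t => Real.sin (ω * t)) (Set.uIcc 0 T) := by fun_prop
  exact ((h3.mul (continuousOn_primitive_zero h1)).add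
    (h4.mul (continuousOn_primitive_zero h2))).congr fun t ht =>
      integral_cos_sub_mul ω (intervalIntegrable_mono_zero hx ht)

theorem continuousOn_integral_sin_sub_mul (ω : ℝ) (hx : IntervalIntegrable x volume 0 T) :
    ContinuousOn (fun t => ∫ s in (0 : ℝ)..t, Real.sin (ω * (t - s)) * x s) (Set.uIcc 0 T) := by
  have h1 : IntervalIntegrable (fun s => Real.cos (ω * s) * x s) volume 0 T :=
    hx.continuousOn_mul (by fun_prop)
  have h2 : IntervalIntegrable (fun s => Real.sin (ω * s) * x s) volume 0 T :=
    hx.continuousOn_mul (by fun_prop)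
  have h3 : ContinuousOn (fun t => Real.cos (ω * t)) (Set.uIcc 0 T) := by fun_prop
  have h4 : ContinuousOn (fun t => Real.sin (ω * t)) (Set.uIcc 0 T) := by fun_prop
  exact ((h4.mul (continuousOn_primitive_zero h1)).sub
    (h3.mul (continuousOn_primitive_zero h2))).congr fun t ht =>
      integral_sin_sub_mul ω (intervalIntegrable_mono_zero hx ht)

theorem intervalIntegrable_causal_cos (ω : ℝ) (hx : IntervalIntegrable x volume 0 T)
    (hy : IntervalIntegrable y volume 0 T) : IntervalIntegrable
      (fun t => y t * ∫ s in (0 : ℝ)..t, Real.cos (ω * (t - s)) * x s) volume 0 T :=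
  hy.mul_continuousOn (continuousOn_integral_cos_sub_mul ω hx)

theorem intervalIntegrable_causal_sin (ω : ℝ) (hx : IntervalIntegrable x volume 0 T)
    (hy : IntervalIntegrable y volume 0 T) : IntervalIntegrable
      (fun t => y t * ∫ s in (0 : ℝ)..t, Real.sin (ω * (t - s)) * x s) volume 0 T :=
  hy.mul_continuousOn (continuousOn_integral_sin_sub_mul ω hx)

/-- The kernel is even in `t - s`, so exchanging `x` and `y` supplies the missing triangle of the
square. There the kernel is a sum of two products; in terms of primitives this is the product rule.
-/
theorem causalForm_cos_symm (ω : ℝ) (hx : IntervalIntegrable x volume 0 T)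
    (hy : IntervalIntegrable y volume 0 T) :
    causalForm T (fun u => Real.cos (ω * u)) x y + causalForm T (fun u => Real.cos (ω * u)) y x =
      (∫ t in (0 : ℝ)..T, Real.cos (ω * t) * x t) * (∫ t in (0 : ℝ)..T, Real.cos (ω * t) * y t) +
      (∫ t in (0 : ℝ)..T, Real.sin (ω * t) * x t) * (∫ t in (0 : ℝ)..T, Real.sin (ω * t) * y t) := by
  have hc : ∀ {z : ℝ → ℝ}, IntervalIntegrable z volume 0 T →
      IntervalIntegrable (fun s => Real.cos (ω * s) * z s) volume 0 T :=
    fun h => h.continuousOn_mul (by fun_prop)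
  have hs : ∀ {z : ℝ → ℝ}, IntervalIntegrable z volume 0 T →
      IntervalIntegrable (fun s => Real.sin (ω * s) * z s) volume 0 T :=
    fun h => h.continuousOn_mul (by fun_prop)
  have hr : ∀ {u v : ℝ → ℝ}, IntervalIntegrable u volume 0 T → IntervalIntegrable v volume 0 T →
      IntervalIntegrable (fun s => u s * (∫ w in (0 : ℝ)..s, v w) +
        (∫ w in (0 : ℝ)..s, u w) * v s) volume 0 T := fun hu hv =>
    (hu.mul_continuousOn (continuousOn_primitive_zero hv)).add
      (hv.continuousOn_mul (continuousOn_primitive_zero hu))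
  rw [causalForm, causalForm, ← intervalIntegral.integral_add
    (intervalIntegrable_causal_cos ω hx hy) (intervalIntegrable_causal_cos ω hy hx),
    ← integral_mul_primitive_add (hc hx) (hc hy), ← integral_mul_primitive_add (hs hx) (hs hy),
    ← intervalIntegral.integral_add (hr (hc hx) (hc hy)) (hr (hs hx) (hs hy))]
  refine intervalIntegral.integral_congr fun t ht => ?_
  simp only [integral_cos_sub_mul ω (intervalIntegrable_mono_zero hx ht),
    integral_cos_sub_mul ω (intervalIntegrable_mono_zero hy ht)]
  ring

/-- Dominated convergence is applied twice: to the inner integral with bound `c k |x|`, then to the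
outer one with bound `c k |y| ∫|x|`. The expansion of `φ` is needed only on `[0, T]`, where `t - s`
lives. -/
theorem hasSum_causalForm (hT : 0 ≤ T) (hx : IntervalIntegrable x volume 0 T)
    (hy : IntervalIntegrable y volume 0 T) {c ω : ℕ → ℝ} {φ : ℝ → ℝ} (hc : Summable c)
    (hc0 : ∀ k, 0 ≤ c k)
    (hφ : ∀ u ∈ Set.Icc 0 T, HasSum (fun k => c k * Real.cos (ω k * u)) (φ u)) :
    HasSum (fun k => c k * causalForm T (fun u => Real.cos (ω k * u)) x y)
      (causalForm T φ x y) := by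
  have hinner : ∀ t ∈ Set.uIcc 0 T, HasSum
      (fun k => c k * ∫ s in (0 : ℝ)..t, Real.cos (ω k * (t - s)) * x s)
      (∫ s in (0 : ℝ)..t, φ (t - s) * x s) := by
    intro t ht
    have hxt := intervalIntegrable_mono_zero hx ht
    rw [Set.uIcc_of_le hT] at ht
    simp_rw [← intervalIntegral.integral_const_mul]
    refine intervalIntegral.hasSum_integral_of_dominated_convergence (fun k s => c k * |x s|)
      ?_ ?_ ?_ ?_ ?_
    · intro k
      have h1 : IntervalIntegrable (fun s => Real.cos (ω k * (t - s)) * x s) volume 0 t :=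
        hxt.continuousOn_mul (by fun_prop)
      exact (intervalIntegrable_iff.1 (h1.const_mul (c k))).aestronglyMeasurable
    · intro k
      refine Filter.Eventually.of_forall fun s _ => ?_
      rw [norm_mul, norm_mul, Real.norm_of_nonneg (hc0 k), Real.norm_eq_abs, Real.norm_eq_abs]
      refine mul_le_mul_of_nonneg_left ?_ (hc0 k)
      exact mul_le_of_le_one_left (abs_nonneg _) (Real.abs_cos_le_one _)
    · exact Filter.Eventually.of_forall fun s _ => hc.mul_right _
    · simp_rw [tsum_mul_right]
      exact hxt.abs.const_mul _
    · refine Filter.Eventually.of_forall fun s hs => ?_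
      rw [Set.uIoc_of_le ht.1] at hs
      have := (hφ (t - s) ⟨by linarith [hs.2], by linarith [hs.1, ht.2]⟩).mul_right (x s)
      simpa only [mul_assoc] using this
  have hbound : ∀ (k : ℕ), ∀ t ∈ Set.uIcc 0 T, |∫ s in (0 : ℝ)..t, Real.cos (ω k * (t - s)) * x s|
      ≤ ∫ s in (0 : ℝ)..T, |x s| := by
    intro k t ht
    have hxt := intervalIntegrable_mono_zero hx ht
    rw [Set.uIcc_of_le hT] at ht
    have h1 : IntervalIntegrable (fun s => Real.cos (ω k * (t - s)) * x s) volume 0 t :=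
      hxt.continuousOn_mul (by fun_prop)
    calc |∫ s in (0 : ℝ)..t, Real.cos (ω k * (t - s)) * x s|
        ≤ ∫ s in (0 : ℝ)..t, |Real.cos (ω k * (t - s)) * x s| :=
          intervalIntegral.abs_integral_le_integral_abs ht.1
      _ ≤ ∫ s in (0 : ℝ)..t, |x s| :=
          intervalIntegral.integral_mono_on ht.1 h1.abs hxt.abs fun s _ => by
            rw [abs_mul]
            exact mul_le_of_le_one_left (abs_nonneg _) (Real.abs_cos_le_one _)
      _ ≤ ∫ s in (0 : ℝ)..T, |x s| :=
          intervalIntegral.integral_mono_interval le_rfl ht.1 ht.2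
            (Filter.Eventually.of_forall fun s => abs_nonneg _) hx.abs
  unfold causalForm
  refine (congrArg (fun g => HasSum g _) (funext fun k =>
    intervalIntegral.integral_const_mul (c k) fun t => y t * ∫ s in (0 : ℝ)..t,
      Real.cos (ω k * (t - s)) * x s)).mp ?_
  refine intervalIntegral.hasSum_integral_of_dominated_convergence
    (fun k t => c k * (|y t| * ∫ s in (0 : ℝ)..T, |x s|)) ?_ ?_ ?_ ?_ ?_
  · intro k
    exact (intervalIntegrable_iff.1
      ((intervalIntegrable_causal_cos (ω k) hx hy).const_mul (c k))).aestronglyMeasurable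
  · intro k
    refine Filter.Eventually.of_forall fun t ht => ?_
    rw [norm_mul, norm_mul, Real.norm_of_nonneg (hc0 k), Real.norm_eq_abs, Real.norm_eq_abs]
    exact mul_le_mul_of_nonneg_left (mul_le_mul_of_nonneg_left
      (hbound k t (Set.uIoc_subset_uIcc ht)) (abs_nonneg _)) (hc0 k)
  · exact Filter.Eventually.of_forall fun t _ => hc.mul_right _
  · simp_rw [tsum_mul_right]
    exact (hy.abs.mul_const _).const_mul _
  · refine Filter.Eventually.of_forall fun t ht => ?_
    have := (hinner t (Set.uIoc_subset_uIcc ht)).mul_left (y t)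
    simpa only [mul_left_comm] using this

/-- A combination of a constant and trigonometric functions. -/
def trigKernel (a r p ε u : ℝ) : ℝ :=
  a + r * Real.cos (ε * u) - Real.sin (ε * u) + p * Real.cos u

/-- The constant is written as the cosine of frequency `0`, so that it falls under the same lemmas
as the other terms. -/
theorem integral_trigKernel_sub_mul (a r p ε : ℝ) {t : ℝ} (hx : IntervalIntegrable x volume 0 t) :
    ∫ s in (0 : ℝ)..t, trigKernel a r p ε (t - s) * x s =
      a * (∫ s in (0 : ℝ)..t, Real.cos (0 * (t - s)) * x s) +
      r * (∫ s in (0 : ℝ)..t, Real.cos (ε * (t - s)) * x s) -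
      (∫ s in (0 : ℝ)..t, Real.sin (ε * (t - s)) * x s) +
      p * ∫ s in (0 : ℝ)..t, Real.cos (1 * (t - s)) * x s := by
  have hc : ∀ ω : ℝ, IntervalIntegrable (fun s => Real.cos (ω * (t - s)) * x s) volume 0 t :=
    fun ω => hx.continuousOn_mul (by fun_prop)
  have hs : IntervalIntegrable (fun s => Real.sin (ε * (t - s)) * x s) volume 0 t :=
    hx.continuousOn_mul (by fun_prop)
  rw [← intervalIntegral.integral_const_mul, ← intervalIntegral.integral_const_mul,
    ← intervalIntegral.integral_const_mul,
    ← intervalIntegral.integral_add ((hc 0).const_mul a) ((hc ε).const_mul r),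
    ← intervalIntegral.integral_sub (((hc 0).const_mul a).add ((hc ε).const_mul r)) hs,
    ← intervalIntegral.integral_add ((((hc 0).const_mul a).add ((hc ε).const_mul r)).sub hs)
      ((hc 1).const_mul p)]
  refine intervalIntegral.integral_congr fun s _ => ?_
  simp only [trigKernel, zero_mul, Real.cos_zero, one_mul]
  ring

theorem intervalIntegrable_causal_trigKernel (a r p ε : ℝ) (hx : IntervalIntegrable x volume 0 T)
    (hy : IntervalIntegrable y volume 0 T) : IntervalIntegrable
      (fun t => y t * ∫ s in (0 : ℝ)..t, trigKernel a r p ε (t - s) * x s) volume 0 T := by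
  refine hy.mul_continuousOn ((((((continuousOn_integral_cos_sub_mul 0 hx).const_smul a).add
    ((continuousOn_integral_cos_sub_mul ε hx).const_smul r)).sub
    (continuousOn_integral_sin_sub_mul ε hx)).add
    ((continuousOn_integral_cos_sub_mul 1 hx).const_smul p)).congr fun t ht => ?_)
  exact integral_trigKernel_sub_mul a r p ε (intervalIntegrable_mono_zero hx ht)

theorem causalForm_trigKernel (a r p ε : ℝ) (hx : IntervalIntegrable x volume 0 T)
    (hy : IntervalIntegrable y volume 0 T) :
    causalForm T (trigKernel a r p ε) x y =
      a * causalForm T (fun u => Real.cos (0 * u)) x y +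
      r * causalForm T (fun u => Real.cos (ε * u)) x y -
      causalForm T (fun u => Real.sin (ε * u)) x y +
      p * causalForm T (fun u => Real.cos (1 * u)) x y := by
  unfold causalForm
  rw [← intervalIntegral.integral_const_mul, ← intervalIntegral.integral_const_mul,
    ← intervalIntegral.integral_const_mul,
    ← intervalIntegral.integral_add ((intervalIntegrable_causal_cos 0 hx hy).const_mul a)
      ((intervalIntegrable_causal_cos ε hx hy).const_mul r),
    ← intervalIntegral.integral_sub (((intervalIntegrable_causal_cos 0 hx hy).const_mul a).add
      ((intervalIntegrable_causal_cos ε hx hy).const_mul r))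
      (intervalIntegrable_causal_sin ε hx hy),
    ← intervalIntegral.integral_add ((((intervalIntegrable_causal_cos 0 hx hy).const_mul a).add
      ((intervalIntegrable_causal_cos ε hx hy).const_mul r)).sub
      (intervalIntegrable_causal_sin ε hx hy))
      ((intervalIntegrable_causal_cos 1 hx hy).const_mul p)]
  refine intervalIntegral.integral_congr fun t ht => ?_
  simp only [integral_trigKernel_sub_mul a r p ε (intervalIntegrable_mono_zero hx ht)]
  ring

/-- The symmetrized form of a trigonometric kernel on a half period of `sin (ε ·)`. -/
theorem hasSum_causalForm_trigKernel (a r p : ℝ) {ε : ℝ} (hε : 0 < ε)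
    (α β : Control (finalTime ε)) :
    HasSum (fun k : ℕ => 4 / (Real.pi * (4 * ((k : ℝ) + 1) ^ 2 - 1)) *
        harmonicForm (2 * ((k : ℝ) + 1) * ε) α β)
      (causalForm (finalTime ε) (trigKernel a r p ε) α β +
        causalForm (finalTime ε) (trigKernel a r p ε) β α -
        ((a - 2 / Real.pi) * projForm (fun _ => 1) α β + p * harmonicForm 1 α β +
          r * harmonicForm ε α β)) := by
  have hT : 0 ≤ finalTime ε := by unfold finalTime; positivity
  have hα := α.intervalIntegrable hT
  have hβ := β.intervalIntegrable hT
  -- The kernel with constant `2/π` and no cosines is `2/π - sin (ε u)`. The choice `T = π/ε` keeps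
  -- `ε u` in `[0, π]`, where the series is valid.
  have hφ : ∀ u ∈ Set.Icc 0 (finalTime ε), HasSum (fun k : ℕ =>
      4 / (Real.pi * (4 * ((k : ℝ) + 1) ^ 2 - 1)) * Real.cos (2 * ((k : ℝ) + 1) * ε * u))
      (trigKernel (2 / Real.pi) 0 0 ε u) := by
    intro u hu
    have h1 : ε * u ∈ Set.Icc 0 Real.pi := by
      refine ⟨mul_nonneg hε.le hu.1, ?_⟩
      have := mul_le_mul_of_nonneg_left hu.2 hε.le
      rwa [finalTime, mul_div_cancel₀ _ hε.ne'] at this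
    have h2 := hasSum_sin h1
    simp only [← mul_assoc] at h2
    convert! h2 using 1
    simp [trigKernel]
  have hS := (hasSum_causalForm hT hα hβ summable_sinCoeff (fun k => (sinCoeff_pos k).le) hφ).add
    (hasSum_causalForm hT hβ hα summable_sinCoeff (fun k => (sinCoeff_pos k).le) hφ)
  simp only [← mul_add, causalForm_cos_symm _ hα hβ] at hS
  have h0 := causalForm_cos_symm 0 hα hβ
  have h1 := causalForm_cos_symm 1 hα hβ
  have he := causalForm_cos_symm ε hα hβ
  simp only [zero_mul, Real.cos_zero, Real.sin_zero, intervalIntegral.integral_zero, add_zero]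
    at h0
  convert! hS using 1
  -- Both kernels are split into elementary ones. Their sine parts agree and cancel, which leaves
  -- the constant `a - 2/π` and the pure cosines.
  rw [causalForm_trigKernel _ _ _ _ hα hβ, causalForm_trigKernel _ _ _ _ hβ hα,
    causalForm_trigKernel _ _ _ _ hα hβ, causalForm_trigKernel _ _ _ _ hβ hα]
  simp only [zero_mul, Real.cos_zero]
  simp only [harmonicForm, projForm]
  linear_combination (a - 2 / Real.pi) * h0 + p * h1 + r * he

end Causal

/-! ### Propagators as solutions of Volterra equations -/

section Propagator

variable {N : ℕ} {T : ℝ}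

/-- The operator `X ↦ -i M X` on matrices with the sup norm. -/
def schroedinger (N : ℕ) : Matrix (Fin N) (Fin N) ℂ →ₗ[ℝ]
    ((Fin N → Fin N → ℂ) →L[ℝ] (Fin N → Fin N → ℂ)) where
  toFun M := LinearMap.toContinuousLinearMap
    { toFun := fun X i j => -I * (M * Matrix.of X) i j
      map_add' := fun X Y => by
        ext i j
        simp [Matrix.mul_apply, mul_add, Finset.sum_add_distrib]
      map_smul' := fun c X => by
        ext i j
        simp only [Matrix.mul_apply, Matrix.of_apply, Pi.smul_apply, real_smul, RingHom.id_apply,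
          Finset.mul_sum]
        exact Finset.sum_congr rfl fun k _ => by ring }
  map_add' M₁ M₂ := by
    ext X i j
    simp [Matrix.add_mul, mul_add]
  map_smul' c M := by
    ext X i j
    simp only [LinearMap.coe_toContinuousLinearMap', LinearMap.coe_mk, AddHom.coe_mk,
      RingHom.id_apply, _root_.smul_apply, Pi.smul_apply, Matrix.smul_mul, Matrix.smul_apply,
      real_smul]
    ring

theorem schroedinger_apply (M : Matrix (Fin N) (Fin N) ℂ) (X : Fin N → Fin N → ℂ) (i j : Fin N) :
    schroedinger N M X i j = -I * (M * Matrix.of X) i j := rfl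

theorem continuous_schroedinger {M : ℝ → Matrix (Fin N) (Fin N) ℂ} (hM : Continuous M) :
    Continuous fun s => schroedinger N (M s) :=
  (schroedinger N).continuous_of_finiteDimensional.comp hM

theorem intervalIntegral_entry {F : ℝ → Fin N → Fin N → ℂ} {a b : ℝ}
    (hF : IntervalIntegrable F volume a b) (i j : Fin N) :
    (∫ s in a..b, F s) i j = ∫ s in a..b, F s i j :=
  (((ContinuousLinearMap.proj (R := ℝ) (φ := fun _ : Fin N => ℂ) j).comp
    (ContinuousLinearMap.proj (R := ℝ) (φ := fun _ : Fin N => Fin N → ℂ) i)).intervalIntegral_comp_comm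
      hF).symm

theorem intervalIntegrable_entry {F : ℝ → Fin N → Fin N → ℂ} {a b : ℝ}
    (hF : IntervalIntegrable F volume a b) (i j : Fin N) :
    IntervalIntegrable (fun s => F s i j) volume a b :=
  ⟨((ContinuousLinearMap.proj (R := ℝ) (φ := fun _ : Fin N => ℂ) j).comp
    (ContinuousLinearMap.proj (R := ℝ) (φ := fun _ : Fin N => Fin N → ℂ) i)).integrable_comp hF.1,
   ((ContinuousLinearMap.proj (R := ℝ) (φ := fun _ : Fin N => ℂ) j).comp
    (ContinuousLinearMap.proj (R := ℝ) (φ := fun _ : Fin N => Fin N → ℂ) i)).integrable_comp hF.2⟩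

theorem intervalIntegrable_generator {E : Type*} [NormedAddCommGroup E] [NormedSpace ℝ E]
    (hT : 0 ≤ T) {A B : ℝ → E →L[ℝ] E} (hA : Continuous A) (hB : Continuous B) (p : ℝ × Control T)
    (x : C(Set.Icc 0 T, E)) {t : ℝ} (ht : t ∈ Set.Icc 0 T) :
    IntervalIntegrable (fun s => p.1 • A s (Set.IccExtend hT x s) +
      p.2 s • B s (Set.IccExtend hT x s)) volume 0 t := by
  have hcA := hA.clm_apply (continuous_IccExtend hT x)
  have hcB := hB.clm_apply (continuous_IccExtend hT x)
  exact ((hcA.const_smul p.1).intervalIntegrable _ _).add (p.2.intervalIntegrable_smul hcB ht)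

theorem smul_schroedinger_add (M₀ M₁ : Matrix (Fin N) (Fin N) ℂ) (ℓ f : ℝ)
    (X : Fin N → Fin N → ℂ) (i j : Fin N) :
    (ℓ • schroedinger N M₀ X + f • schroedinger N M₁ X) i j =
      -I * (((ℓ : ℂ) • M₀ + (f : ℂ) • M₁) * Matrix.of X) i j := by
  simp only [Pi.add_apply, Pi.smul_apply, schroedinger_apply, Matrix.add_mul, Matrix.smul_mul,
    Matrix.add_apply, Matrix.smul_apply, real_smul, smul_eq_mul]
  ring

/-- The entries of the identity matrix. -/
def idEntries (N : ℕ) : Fin N → Fin N → ℂ := fun i j => (1 : Matrix (Fin N) (Fin N) ℂ) i j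

variable {M₀ M₁ : ℝ → Matrix (Fin N) (Fin N) ℂ}

theorem intervalIntegrable_schroedinger (hT : 0 ≤ T) (hM₀ : Continuous M₀) (hM₁ : Continuous M₁)
    (p : ℝ × Control T) (x : C(Set.Icc 0 T, Fin N → Fin N → ℂ)) (i j : Fin N) {t : ℝ}
    (ht : t ∈ Set.Icc 0 T) :
    IntervalIntegrable (fun s => -I * (((p.1 : ℂ) • M₀ s + (p.2 s : ℂ) • M₁ s) *
      Matrix.of (Set.IccExtend hT x s)) i j) volume 0 t := by
  have h := intervalIntegrable_entry (intervalIntegrable_generator hT (continuous_schroedinger hM₀)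
    (continuous_schroedinger hM₁) p x ht) i j
  simpa only [smul_schroedinger_add] using h

theorem eq_evolution_iff_entries (hT : 0 ≤ T) (hM₀ : Continuous M₀) (hM₁ : Continuous M₁)
    (x₀ : Fin N → Fin N → ℂ) (p : ℝ × Control T) (x : C(Set.Icc 0 T, Fin N → Fin N → ℂ)) :
    x = evolution hT (continuous_schroedinger hM₀) (continuous_schroedinger hM₁) x₀ p ↔
      ∀ (t : Set.Icc 0 T) (i j : Fin N), x t i j = x₀ i j +
        ∫ s in (0 : ℝ)..t, -I * (((p.1 : ℂ) • M₀ s + (p.2 s : ℂ) • M₁ s) *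
          Matrix.of (Set.IccExtend hT x s)) i j := by
  rw [eq_evolution_iff]
  refine forall_congr' fun t => ?_
  have hint := intervalIntegrable_generator hT (continuous_schroedinger hM₀)
    (continuous_schroedinger hM₁) p x t.2
  have h1 : ∀ i j, (∫ s in (0 : ℝ)..t, (p.1 • schroedinger N (M₀ s) (Set.IccExtend hT x s) +
      p.2 s • schroedinger N (M₁ s) (Set.IccExtend hT x s))) i j =
      ∫ s in (0 : ℝ)..t, -I * (((p.1 : ℂ) • M₀ s + (p.2 s : ℂ) • M₁ s) *
          Matrix.of (Set.IccExtend hT x s)) i j := by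
    intro i j
    rw [intervalIntegral_entry hint]
    simp_rw [smul_schroedinger_add]
  constructor
  · intro h i j
    rw [h, Pi.add_apply, Pi.add_apply, h1]
  · intro h
    ext i j
    rw [h, Pi.add_apply, Pi.add_apply, h1]

variable {H₀ H₁ : Matrix (Fin N) (Fin N) ℂ}

theorem IsPropagator.eqOn_evolution (hT : 0 ≤ T) {ℓ : ℝ} {f : Control T}
    {U : ℝ → Matrix (Fin N) (Fin N) ℂ} (hU : IsPropagator H₀ H₁ T ℓ f U) (t : Set.Icc 0 T) :
    U t = Matrix.of (evolution hT (continuous_schroedinger (continuous_const (y := H₀)))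
      (continuous_schroedinger (continuous_const (y := H₁)))
      (idEntries N) (ℓ, f) t) := by
  let x : C(Set.Icc 0 T, Fin N → Fin N → ℂ) :=
    ⟨fun t => U t, continuousOn_iff_continuous_domRestrict.1 hU.1⟩
  have hx : x = evolution hT (continuous_schroedinger (continuous_const (y := H₀)))
      (continuous_schroedinger (continuous_const (y := H₁)))
      (idEntries N) (ℓ, f) := by
    rw [eq_evolution_iff_entries hT continuous_const continuous_const]
    intro t i j
    change U t i j = _
    rw [hU.2 t t.2 i j, sub_eq_add_neg, ← neg_mul, intervalIntegral.integral_const_mul]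
    congr 2
    refine intervalIntegral.integral_congr fun s hs => ?_
    rw [Set.uIcc_of_le t.2.1] at hs
    have hs' : s ∈ Set.Icc 0 T := ⟨hs.1, hs.2.trans t.2.2⟩
    rw [Set.IccExtend_of_mem hT _ hs']
    rfl
  rw [← hx]
  rfl

/-- Uniqueness makes the arbitrary choice in `finalPropagator` immaterial. -/
theorem finalPropagator_eq (hT : 0 ≤ T) {ℓ : ℝ} {f : Control T}
    {U : ℝ → Matrix (Fin N) (Fin N) ℂ} (hU : IsPropagator H₀ H₁ T ℓ f U) :
    finalPropagator H₀ H₁ T ℓ f = U T := by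
  have h : ∃ U, IsPropagator H₀ H₁ T ℓ f U := ⟨U, hU⟩
  rw [finalPropagator, dif_pos h]
  exact (h.choose_spec.eqOn_evolution hT ⟨T, hT, le_rfl⟩).trans
    (hU.eqOn_evolution hT ⟨T, hT, le_rfl⟩).symm

/-! ### The interaction picture -/

/-- The matrix `e^{isD} H e^{-isD}` with `D = diagonal e`. -/
def interaction (e : Fin N → ℝ) (H : Matrix (Fin N) (Fin N) ℂ) (s : ℝ) :
    Matrix (Fin N) (Fin N) ℂ :=
  Matrix.of fun j k => exp (I * ((e j - e k) * s)) * H j k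

theorem continuous_interaction (e : Fin N → ℝ) (H : Matrix (Fin N) (Fin N) ℂ) :
    Continuous (interaction e H) := by
  refine continuous_matrix fun j k => ?_
  simp only [interaction, Matrix.of_apply]
  fun_prop

/-- The drift, as a constant path of matrices. -/
def driftPath (e : Fin N → ℝ) (_ : ℝ) : Matrix (Fin N) (Fin N) ℂ :=
  Matrix.diagonal fun i => (e i : ℂ)

theorem continuous_driftPath (e : Fin N → ℝ) : Continuous (driftPath e) := continuous_const

/-- The propagator in the interaction picture of `diagonal e`. -/
def interactionEvolution (hT : 0 ≤ T) (e : Fin N → ℝ) (H : Matrix (Fin N) (Fin N) ℂ)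
    (p : ℝ × Control T) : C(Set.Icc 0 T, Fin N → Fin N → ℂ) :=
  evolution hT (continuous_schroedinger (continuous_driftPath e))
    (continuous_schroedinger (continuous_interaction e H)) (idEntries N) p

theorem integral_phase (a : ℂ) (t : ℝ) :
    ∫ s in (0 : ℝ)..t, a * exp (a * s) = exp (a * t) - 1 := by
  have h : ∀ x : ℝ, HasDerivAt (fun s : ℝ => exp (a * s)) (a * exp (a * x)) x := by
    intro x
    have h1 : HasDerivAt (fun s : ℂ => exp (a * s)) (a * exp (a * x)) (x : ℂ) := by
      simpa [mul_comm] using ((hasDerivAt_id (x : ℂ)).const_mul a).cexp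
    exact h1.comp_ofReal
  rw [intervalIntegral.integral_eq_sub_of_hasDerivAt (fun x _ => h x)
    ((by fun_prop : Continuous fun s : ℝ => a * exp (a * s)).intervalIntegrable _ _)]
  simp

/-- The product rule for `e^{at} (w₀ + ∫₀ᵗ w)`. -/
theorem exp_mul_primitive {w : ℝ → ℂ} {t : ℝ} (hw : IntervalIntegrable w volume 0 t) (a w₀ : ℂ) :
    exp (a * t) * (w₀ + ∫ s in (0 : ℝ)..t, w s) = w₀ +
      ∫ s in (0 : ℝ)..t, (exp (a * s) * w s +
        a * (exp (a * s) * (w₀ + ∫ v in (0 : ℝ)..s, w v))) := by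
  have hm : Continuous fun s : ℝ => a * exp (a * s) := by fun_prop
  have hmi : IntervalIntegrable (fun s : ℝ => a * exp (a * s)) volume 0 t :=
    hm.intervalIntegrable _ _
  have h := integral_mul_primitive_add_complex hw hmi
  simp only [integral_phase] at h
  have h1 : IntervalIntegrable (fun s => w s * (exp (a * s) - 1) +
      (∫ v in (0 : ℝ)..s, w v) * (a * exp (a * s))) volume 0 t :=
    (hw.mul_continuousOn (by fun_prop)).add
      (hmi.continuousOn_mul (continuousOn_primitive_zero hw))
  have h2 : ∫ s in (0 : ℝ)..t, (exp (a * s) * w s +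
        a * (exp (a * s) * (w₀ + ∫ v in (0 : ℝ)..s, w v))) =
      (∫ s in (0 : ℝ)..t, (w s * (exp (a * s) - 1) +
        (∫ v in (0 : ℝ)..s, w v) * (a * exp (a * s)))) +
      ((∫ s in (0 : ℝ)..t, w s) + w₀ * ∫ s in (0 : ℝ)..t, a * exp (a * s)) := by
    rw [← intervalIntegral.integral_const_mul, ← intervalIntegral.integral_add hw (hmi.const_mul w₀),
      ← intervalIntegral.integral_add h1 (hw.add (hmi.const_mul w₀))]
    refine intervalIntegral.integral_congr fun s _ => ?_
    ring
  rw [h2, h, integral_phase]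
  ring

/-- Only the unit multiple of the drift is transformed away. The excess `p.1` remains as a
generator, unchanged because the drift commutes with its own exponential, so `p` measures the
deviation from `(1, 0)`. -/
theorem isPropagator_interactionEvolution (hT : 0 ≤ T) (e : Fin N → ℝ)
    (H : Matrix (Fin N) (Fin N) ℂ) (p : ℝ × Control T) :
    IsPropagator (Matrix.diagonal fun i => (e i : ℂ)) H T (1 + p.1) p.2
      (fun t => Matrix.of fun i j => exp (-I * e i * t) *
        Set.IccExtend hT (interactionEvolution hT e H p) t i j) := by
  have hW := (eq_evolution_iff_entries hT (continuous_driftPath e) (continuous_interaction e H)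
    (idEntries N) p (interactionEvolution hT e H p)).1 rfl
  set W := interactionEvolution hT e H p with hWdef
  constructor
  · refine Continuous.continuousOn (continuous_matrix fun i j => ?_)
    have h := continuous_IccExtend hT W
    simp only [Matrix.of_apply]
    fun_prop
  · intro t ht i j
    have hw := intervalIntegrable_schroedinger hT (continuous_driftPath e)
      (continuous_interaction e H) p W i j ht
    have hWs : ∀ s ∈ Set.Icc 0 T, Set.IccExtend hT W s i j = (1 : Matrix (Fin N) (Fin N) ℂ) i j +
        ∫ v in (0 : ℝ)..s, -I * (((p.1 : ℂ) • driftPath e v + (p.2 v : ℂ) • interaction e H v) *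
          Matrix.of (Set.IccExtend hT W v)) i j := by
      intro s hs
      rw [Set.IccExtend_of_mem hT _ hs]
      exact hW ⟨s, hs⟩ i j
    change exp (-I * e i * t) * Set.IccExtend hT W t i j = _
    rw [hWs t ht, exp_mul_primitive hw (-I * e i), sub_eq_add_neg, ← neg_mul,
      ← intervalIntegral.integral_const_mul]
    congr 1
    refine intervalIntegral.integral_congr fun s hs => ?_
    rw [Set.uIcc_of_le ht.1] at hs
    beta_reduce
    rw [← hWs s ⟨hs.1, hs.2.trans ht.2⟩]
    simp only [Matrix.add_mul, Matrix.smul_mul, Matrix.add_apply, Matrix.smul_apply, smul_eq_mul,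
      driftPath, Matrix.diagonal_mul, Matrix.of_apply]
    have h3 : exp (-I * e i * s) * (interaction e H s * Matrix.of (Set.IccExtend hT W s)) i j =
        (H * Matrix.of fun i j => exp (-I * e i * s) * Set.IccExtend hT W s i j) i j := by
      simp only [Matrix.mul_apply, interaction, Matrix.of_apply, Finset.mul_sum]
      refine Finset.sum_congr rfl fun k _ => ?_
      have : exp (-I * e k * s) = exp (-I * e i * s) * exp (I * ((e i - e k) * s)) := by
        rw [← Complex.exp_add]; congr 1; ring
      rw [this]
      ring
    rw [← h3]
    push_cast
    ring

end Propagator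

/-! ### The four-level system in the interaction picture -/

/-- The energy levels of the drift. -/
def levels (ε : ℝ) : Fin 4 → ℝ := ![1 + ε, 1, 2, 3]

theorem drift_eq_diagonal (ε : ℝ) : drift ε = Matrix.diagonal fun i => (levels ε i : ℂ) := by
  rw [drift]
  congr 1
  funext i
  fin_cases i <;> simp [levels]

/-- The entries of the control Hamiltonian, as real numbers. -/
def controlReal : Matrix (Fin 4) (Fin 4) ℝ :=
  !![0, 1, 0, 0; 1, bPar, 1, 0; 0, 1, cPar, gPar; 0, 0, gPar, dPar]

theorem control_apply (i j : Fin 4) : control i j = (controlReal i j : ℂ) := by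
  fin_cases i <;> fin_cases j <;> simp [control, coupling, controlReal]

/-- The first factor of `V†` with the specified parameters. -/
def core (γ : ℝ) : Matrix (Fin 4) (Fin 4) ℂ := targetCore rPar θPar φPar γ

theorem finalTime_nonneg {ε : ℝ} (hε : 0 < ε) : 0 ≤ finalTime ε :=
  div_nonneg Real.pi_pos.le hε.le

theorem rPar_bounds : 0 < rPar ∧ rPar < 1 := by
  have h1 : √3 < 2 := by rw [Real.sqrt_lt' (by norm_num)]; norm_num
  have h2 : 0 ≤ √3 := Real.sqrt_nonneg 3
  unfold rPar
  constructor <;> linarith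

theorem sqrt_three_sq : √3 ^ 2 = 3 := Real.sq_sqrt (by norm_num)

theorem exp_φPar : exp (I * (φPar : ℂ)) = ((1 / 2 : ℝ) : ℂ) + ((√3 / 2 : ℝ) : ℂ) * I := by
  rw [mul_comm, exp_mul_I, ← ofReal_cos, ← ofReal_sin, φPar, Real.cos_pi_div_three,
    Real.sin_pi_div_three]

theorem exp_θPar : exp (I * (θPar : ℂ)) = ((1 / 2 : ℝ) : ℂ) + ((-(√3 / 2) : ℝ) : ℂ) * I := by
  rw [mul_comm, exp_mul_I, ← ofReal_cos, ← ofReal_sin, θPar, Real.cos_neg, Real.sin_neg,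
    Real.cos_pi_div_three, Real.sin_pi_div_three]

/-- The functional `X ↦ (1/4) Re Tr (core X)`. -/
def overlap (γ : ℝ) : (Fin 4 → Fin 4 → ℂ) →L[ℝ] ℝ :=
  LinearMap.toContinuousLinearMap
    { toFun := fun X => 1 / 4 * (core γ * Matrix.of X).trace.re
      map_add' := fun X Y => by
        have h : Matrix.of (X + Y) = Matrix.of X + Matrix.of Y := rfl
        rw [h, Matrix.mul_add, Matrix.trace_add, add_re, mul_add]
      map_smul' := fun c X => by
        rw [← Matrix.smul_of, Matrix.mul_smul, Matrix.trace_smul, real_smul, re_ofReal_mul,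
          RingHom.id_apply, smul_eq_mul]
        ring }

theorem overlap_apply (γ : ℝ) (X : Fin 4 → Fin 4 → ℂ) :
    overlap γ X = 1 / 4 * (core γ * Matrix.of X).trace.re := rfl

/-- In the trace, the off-diagonal entries of `core γ` meet only the corners of `X`. All first- and
second-order Dyson terms have zero corners, so `γ` and `s` drop out. -/
theorem overlap_of_corner_eq_zero (γ : ℝ) {X : Fin 4 → Fin 4 → ℂ} (h30 : X 3 0 = 0)
    (h03 : X 0 3 = 0) :
    overlap γ X = 1 / 4 * (rPar * (X 0 0).re + (X 1 1).im + ((X 2 2).re / 2 - √3 / 2 * (X 2 2).im) +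
      rPar * ((X 3 3).re / 2 + √3 / 2 * (X 3 3).im)) := by
  rw [overlap_apply, Matrix.trace, Fin.sum_univ_four]
  simp only [Matrix.diag_apply, Matrix.mul_apply, Fin.sum_univ_four, core, targetCore, exp_φPar,
    exp_θPar, Matrix.of_apply, h30, h03]
  simp
  ring

theorem conjTranspose_gate (ε γ : ℝ) : (gate ε γ)ᴴ =
    core γ * Matrix.diagonal fun i => exp (I * levels ε i * finalTime ε) := by
  rw [gate, target, Matrix.conjTranspose_conjTranspose, core, drift_eq_diagonal,
    ← Matrix.diagonal_smul, Matrix.exp_diagonal]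
  congr 2
  funext i
  rw [Pi.coe_exp, ← Complex.exp_eq_exp_ℂ]
  simp only [Pi.smul_apply, smul_eq_mul]
  congr 1
  ring

/-- The factor `e^{iTH₀}` in the target undoes the passage back from the interaction picture. -/
theorem gateFidelity_gate (ε γ : ℝ) (X : Fin 4 → Fin 4 → ℂ) :
    gateFidelity (gate ε γ) (Matrix.of fun i j => exp (-I * levels ε i * finalTime ε) * X i j) =
      overlap γ X := by
  have h : (Matrix.of fun i j => exp (-I * levels ε i * finalTime ε) * X i j) =
      Matrix.diagonal (fun i => exp (-I * levels ε i * finalTime ε)) * Matrix.of X := by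
    ext i j
    rw [Matrix.diagonal_mul]; rfl
  rw [gateFidelity, conjTranspose_gate, h, Matrix.mul_assoc, ← Matrix.mul_assoc (diagonal _),
    Matrix.diagonal_mul_diagonal, overlap_apply]
  have h1 : (fun i => exp (I * levels ε i * finalTime ε) * exp (-I * levels ε i * finalTime ε)) =
      fun _ : Fin 4 => (1 : ℂ) := by
    funext i
    rw [← Complex.exp_add, ← Complex.exp_zero]
    congr 1
    ring
  rw [h1, Matrix.diagonal_one, Matrix.one_mul]
  norm_num

/-- The generator of the Volterra equation in the interaction picture. -/
def interactionGenerator {ε : ℝ} (hε : 0 < ε) : (ℝ × Control (finalTime ε)) →L[ℝ]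
    C(Set.Icc 0 (finalTime ε), Fin 4 → Fin 4 → ℂ) →L[ℝ]
      C(Set.Icc 0 (finalTime ε), Fin 4 → Fin 4 → ℂ) :=
  generator (finalTime_nonneg hε) _ _ (continuous_schroedinger (continuous_driftPath (levels ε)))
    (continuous_schroedinger (continuous_interaction (levels ε) control))

/-- The final time as an element of the time interval. -/
def endTime {ε : ℝ} (hε : 0 < ε) : Set.Icc 0 (finalTime ε) :=
  ⟨finalTime ε, finalTime_nonneg hε, le_rfl⟩

/-- The fidelity as a linear functional of the resolvent. -/
def resolventFidelity {ε : ℝ} (hε : 0 < ε) (γ : ℝ) :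
    (C(Set.Icc 0 (finalTime ε), Fin 4 → Fin 4 → ℂ) →L[ℝ]
      C(Set.Icc 0 (finalTime ε), Fin 4 → Fin 4 → ℂ)) →L[ℝ] ℝ :=
  (overlap γ).comp ((ContinuousMap.evalCLM ℝ (endTime hε)).comp
    (ContinuousLinearMap.apply ℝ (C(Set.Icc 0 (finalTime ε), Fin 4 → Fin 4 → ℂ))
      (ContinuousMap.const _ (idEntries 4))))

theorem resolventFidelity_apply {ε : ℝ} (hε : 0 < ε) (γ : ℝ)
    (R : C(Set.Icc 0 (finalTime ε), Fin 4 → Fin 4 → ℂ) →L[ℝ]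
      C(Set.Icc 0 (finalTime ε), Fin 4 → Fin 4 → ℂ)) :
    resolventFidelity hε γ R = overlap γ (R (ContinuousMap.const _ (idEntries 4)) (endTime hε)) :=
  rfl

theorem isPropagator_gate {ε : ℝ} (hε : 0 < ε) (p : ℝ × Control (finalTime ε)) :
    IsPropagator (drift ε) control (finalTime ε) p.1 p.2
      (fun t => Matrix.of fun i j => exp (-I * levels ε i * t) *
        Set.IccExtend (finalTime_nonneg hε) (interactionEvolution (finalTime_nonneg hε) (levels ε)
          control (p - (1, 0))) t i j) := by
  have h := isPropagator_interactionEvolution (finalTime_nonneg hε) (levels ε) control (p - (1, 0))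
  simpa only [drift_eq_diagonal, Prod.fst_sub, Prod.snd_sub, add_sub_cancel, sub_zero] using h

theorem fidelity_eq_overlap {ε : ℝ} (hε : 0 < ε) (γ : ℝ) (p : ℝ × Control (finalTime ε)) :
    fidelity ε γ p = overlap γ (interactionEvolution (finalTime_nonneg hε) (levels ε) control
      (p - (1, 0)) (endTime hε)) := by
  have hext := Set.IccExtend_val (finalTime_nonneg hε) (interactionEvolution (finalTime_nonneg hε)
    (levels ε) control (p - (1, 0))) (endTime hε)
  change Set.IccExtend _ _ (finalTime ε) = _ at hext
  rw [fidelity, objective, finalPropagator_eq (finalTime_nonneg hε) (isPropagator_gate hε p),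
    ← gateFidelity_gate ε γ, hext]

theorem fidelity_eq_resolvent {ε : ℝ} (hε : 0 < ε) (γ : ℝ) :
    fidelity ε γ = fun p => resolventFidelity hε γ
      (Ring.inverse (1 - interactionGenerator hε (p - (1, 0)))) :=
  funext fun p => fidelity_eq_overlap hε γ p

theorem isUnit_one_sub_interactionGenerator {ε : ℝ} (hε : 0 < ε)
    (p : ℝ × Control (finalTime ε)) : IsUnit (1 - interactionGenerator hε p) :=
  isUnit_one_sub_generator _ _ _ p

theorem contDiff_fidelity {ε : ℝ} (hε : 0 < ε) (γ : ℝ) {n : WithTop ℕ∞} :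
    ContDiff ℝ n (fidelity ε γ) := by
  rw [fidelity_eq_resolvent hε γ]
  exact contDiff_inverse_one_sub (R := C(Set.Icc 0 (finalTime ε), Fin 4 → Fin 4 → ℂ) →L[ℝ]
    C(Set.Icc 0 (finalTime ε), Fin 4 → Fin 4 → ℂ)) _ (isUnit_one_sub_interactionGenerator hε) _ _

theorem fderiv_fidelity {ε : ℝ} (hε : 0 < ε) (γ : ℝ) (v : ℝ × Control (finalTime ε)) :
    fderiv ℝ (fidelity ε γ) (1, 0) v = resolventFidelity hε γ (interactionGenerator hε v) := by
  rw [fidelity_eq_resolvent hε γ]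
  exact fderiv_inverse_one_sub (R := C(Set.Icc 0 (finalTime ε), Fin 4 → Fin 4 → ℂ) →L[ℝ]
    C(Set.Icc 0 (finalTime ε), Fin 4 → Fin 4 → ℂ)) _ (isUnit_one_sub_interactionGenerator hε) _ _ v

theorem fderiv_fderiv_fidelity {ε : ℝ} (hε : 0 < ε) (γ : ℝ) (a b : ℝ × Control (finalTime ε)) :
    fderiv ℝ (fderiv ℝ (fidelity ε γ)) (1, 0) a b = resolventFidelity hε γ
      (interactionGenerator hε a * interactionGenerator hε b +
        interactionGenerator hε b * interactionGenerator hε a) := by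
  rw [fidelity_eq_resolvent hε γ]
  exact fderiv_fderiv_inverse_one_sub (R := C(Set.Icc 0 (finalTime ε), Fin 4 → Fin 4 → ℂ) →L[ℝ]
    C(Set.Icc 0 (finalTime ε), Fin 4 → Fin 4 → ℂ)) _ (isUnit_one_sub_interactionGenerator hε) _ _ a b

/-! ### The fidelity without control -/

/-- With no control only the excess drift acts. The diagonal phases satisfy the integral equation,
and uniqueness identifies them. -/
theorem interactionEvolution_zero {ε : ℝ} (hε : 0 < ε) (ℓ : ℝ) (t : Set.Icc 0 (finalTime ε))
    (i j : Fin 4) :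
    interactionEvolution (finalTime_nonneg hε) (levels ε) control (ℓ, 0) t i j =
      exp (((-(ℓ * t * levels ε i) : ℝ) : ℂ) * I) * idEntries 4 i j := by
  let x : C(Set.Icc 0 (finalTime ε), Fin 4 → Fin 4 → ℂ) :=
    ⟨fun t i j => exp (((-(ℓ * t * levels ε i) : ℝ) : ℂ) * I) * idEntries 4 i j, by
      refine continuous_pi fun i => continuous_pi fun j => ?_
      fun_prop⟩
  have hx : x = interactionEvolution (finalTime_nonneg hε) (levels ε) control (ℓ, 0) := by
    rw [interactionEvolution, eq_evolution_iff_entries (finalTime_nonneg hε)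
      (continuous_driftPath (levels ε)) (continuous_interaction (levels ε) control)]
    intro t i j
    have h1 : ∫ s in (0 : ℝ)..t, -I * (((ℓ : ℂ) • driftPath (levels ε) s +
        (((0 : Control (finalTime ε)) s : ℝ) : ℂ) • interaction (levels ε) control s) *
          Matrix.of (Set.IccExtend (finalTime_nonneg hε) x s)) i j =
        ∫ s in (0 : ℝ)..t, (-I * ℓ * levels ε i) * exp ((-I * ℓ * levels ε i) * s) *
          idEntries 4 i j := by
      refine intervalIntegral.integral_congr_ae ?_
      filter_upwards [Control.ae_of_ae (f := (0 : Control (finalTime ε)))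
        (p := fun _ y => y = 0) (Lp.coeFn_zero _ _ _) t.2] with s hs hst
      rw [hs hst]
      rw [Set.uIoc_of_le t.2.1] at hst
      rw [Set.IccExtend_of_mem _ _ ⟨hst.1.le, hst.2.trans t.2.2⟩]
      simp only [ofReal_zero, zero_smul, add_zero, Matrix.smul_mul, Matrix.smul_apply, driftPath,
        Matrix.diagonal_mul, Matrix.of_apply, smul_eq_mul]
      change -I * (ℓ * (levels ε i * (exp (((-(ℓ * s * levels ε i) : ℝ) : ℂ) * I) *
        idEntries 4 i j))) = _
      have : ((-(ℓ * s * levels ε i) : ℝ) : ℂ) * I = -I * ℓ * levels ε i * s := by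
        push_cast; ring
      rw [this]
      ring
    refine Eq.trans ?_ (congrArg (fun z => idEntries 4 i j + z) h1.symm)
    rw [intervalIntegral.integral_mul_const, integral_phase]
    have : -I * ℓ * levels ε i * ((t : ℝ) : ℂ) = ((-(ℓ * t * levels ε i) : ℝ) : ℂ) * I := by
      push_cast; ring
    rw [this]
    change exp (((-(ℓ * t * levels ε i) : ℝ) : ℂ) * I) * idEntries 4 i j = _
    ring
  rw [← hx]
  rfl

theorem fidelity_zero {ε : ℝ} (hε : 0 < ε) (γ ℓ : ℝ) :
    fidelity ε γ (1 + ℓ / finalTime ε, 0) = 1 / 4 * (rPar * Real.cos (ℓ * (1 + ε)) - Real.sin ℓ +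
      (Real.cos (2 * ℓ) / 2 + √3 / 2 * Real.sin (2 * ℓ)) +
      rPar * (Real.cos (3 * ℓ) / 2 - √3 / 2 * Real.sin (3 * ℓ))) := by
  have hT : finalTime ε ≠ 0 := (div_pos Real.pi_pos hε).ne'
  have h0 : ((1 + ℓ / finalTime ε, 0) - (1, 0) : ℝ × Control (finalTime ε)) =
      (ℓ / finalTime ε, 0) := by ext1 <;> simp
  rw [fidelity_eq_overlap hε, h0, overlap_of_corner_eq_zero]
  · have hv : ∀ i, interactionEvolution (finalTime_nonneg hε) (levels ε) control
        (ℓ / finalTime ε, 0) (endTime hε) i i = exp (((-(ℓ * levels ε i) : ℝ) : ℂ) * I) := by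
      intro i
      rw [interactionEvolution_zero hε, idEntries, Matrix.one_apply_eq, mul_one]
      congr 5
      exact div_mul_cancel₀ _ hT
    simp only [hv, exp_ofReal_mul_I_re, exp_ofReal_mul_I_im, Real.cos_neg, Real.sin_neg]
    simp [levels]
    ring_nf
  · rw [interactionEvolution_zero hε]; simp [idEntries]
  · rw [interactionEvolution_zero hε]; simp [idEntries]

theorem fidelity_one_zero {ε : ℝ} (hε : 0 < ε) (γ : ℝ) :
    fidelity ε γ (1, 0) = (9 - 2 * √3) / 24 := by
  have h := fidelity_zero hε γ 0
  simp only [zero_div, add_zero, zero_mul, mul_zero, Real.cos_zero, Real.sin_zero] at h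
  rw [h, rPar]
  ring

theorem exists_fidelity_lt {ε : ℝ} (hε : 0 < ε) (γ : ℝ) :
    ∃ p : ℝ × Control (finalTime ε), 0 < p.1 ∧ fidelity ε γ (1, 0) < fidelity ε γ p := by
  have hT : 0 < finalTime ε := div_pos Real.pi_pos hε
  -- At the angle `7π/6` the second and third levels contribute `1/2` and `1` (the maximum for the
  -- third), and the fourth contributes `√3 r/2`. The first is at least `-r` for every `ε`, which
  -- already beats the value `1/2 + 3r/2` at angle `0`.
  refine ⟨(1 + (Real.pi + Real.pi / 6) / finalTime ε, 0), ?_, ?_⟩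
  · have := Real.pi_pos
    positivity
  · rw [fidelity_zero hε, fidelity_one_zero hε]
    have h1 : Real.sin (Real.pi + Real.pi / 6) = -(1 / 2) := by
      rw [add_comm, Real.sin_add_pi, Real.sin_pi_div_six]
    have e2 : 2 * (Real.pi + Real.pi / 6) = Real.pi / 3 + 2 * Real.pi := by ring
    have e3 : 3 * (Real.pi + Real.pi / 6) = (Real.pi / 2 + Real.pi) + 2 * Real.pi := by ring
    rw [h1, e2, e3, Real.cos_add_two_pi, Real.sin_add_two_pi, Real.cos_add_two_pi,
      Real.sin_add_two_pi, Real.cos_add_pi, Real.sin_add_pi, Real.cos_pi_div_three,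
      Real.sin_pi_div_three, Real.cos_pi_div_two, Real.sin_pi_div_two]
    have h2 := Real.neg_one_le_cos ((Real.pi + Real.pi / 6) * (1 + ε))
    obtain ⟨hr0, hr1⟩ := rPar_bounds
    have hs : 0 < √3 := by positivity
    have h3 : rPar * -1 ≤ rPar * Real.cos ((Real.pi + Real.pi / 6) * (1 + ε)) :=
      mul_le_mul_of_nonneg_left h2 hr0.le
    have h4 : 0 < rPar * √3 := by positivity
    have h5 : rPar = 2 / 9 * (3 - √3) := rfl
    have h6 := sqrt_three_sq
    nlinarith

/-! ### First and second order terms of the Dyson expansion -/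

theorem schroedinger_idEntries {N : ℕ} (M : Matrix (Fin N) (Fin N) ℂ) (i j : Fin N) :
    schroedinger N M (idEntries N) i j = -I * M i j := by
  have h : Matrix.of (idEntries N) = (1 : Matrix (Fin N) (Fin N) ℂ) := rfl
  rw [schroedinger_apply, h, Matrix.mul_one]

theorem schroedinger_schroedinger_idEntries {N : ℕ} (M M' : Matrix (Fin N) (Fin N) ℂ)
    (i j : Fin N) :
    schroedinger N M (schroedinger N M' (idEntries N)) i j = -(M * M') i j := by
  have h : Matrix.of (schroedinger N M' (idEntries N)) = (-I) • M' := by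
    ext i j
    exact schroedinger_idEntries M' i j
  rw [schroedinger_apply, h, Matrix.mul_smul, Matrix.smul_apply, smul_eq_mul, ← mul_assoc]
  linear_combination I_sq * (M * M') i j

theorem interaction_apply_self {N : ℕ} (e : Fin N → ℝ) (H : Matrix (Fin N) (Fin N) ℂ) (s : ℝ)
    (i : Fin N) : interaction e H s i i = H i i := by
  simp [interaction]

/-- Diagonal entries depend on the times only through `t - s`, which is why the second-order term is
a causal convolution form. -/
theorem interaction_control_mul_apply (ε t s : ℝ) (i : Fin 4) :
    (interaction (levels ε) control t * interaction (levels ε) control s) i i =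
      ∑ k, ((controlReal i k * controlReal k i : ℝ) : ℂ) *
        exp ((((levels ε i - levels ε k) * (t - s) : ℝ) : ℂ) * I) := by
  rw [Matrix.mul_apply]
  refine Finset.sum_congr rfl fun k _ => ?_
  simp only [interaction, Matrix.of_apply, control_apply]
  have : exp ((((levels ε i - levels ε k) * (t - s) : ℝ) : ℂ) * I) =
      exp (I * ((levels ε i - levels ε k) * t)) * exp (I * ((levels ε k - levels ε i) * s)) := by
    rw [← Complex.exp_add]
    congr 1
    push_cast
    ring
  rw [this]
  push_cast
  ring

theorem interaction_control_mul_re (ε t s : ℝ) (i : Fin 4) :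
    ((interaction (levels ε) control t * interaction (levels ε) control s) i i).re =
      ∑ k, controlReal i k * controlReal k i * Real.cos ((levels ε i - levels ε k) * (t - s)) := by
  rw [interaction_control_mul_apply, Complex.re_sum]
  simp only [re_ofReal_mul, exp_ofReal_mul_I_re]

theorem interaction_control_mul_im (ε t s : ℝ) (i : Fin 4) :
    ((interaction (levels ε) control t * interaction (levels ε) control s) i i).im =
      ∑ k, controlReal i k * controlReal k i * Real.sin ((levels ε i - levels ε k) * (t - s)) := by
  rw [interaction_control_mul_apply, Complex.im_sum]
  simp only [im_ofReal_mul, exp_ofReal_mul_I_im]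

/-- The equation `-1 + √3 - (3√3/2) r = 0` determines `r`. The first level enters through its
imaginary part alone, so `ε` is absent. -/
theorem overlap_drift (ε γ s : ℝ) :
    overlap γ (schroedinger 4 (driftPath (levels ε) s) (idEntries 4)) = 0 := by
  rw [overlap_of_corner_eq_zero]
  · simp only [schroedinger_idEntries, driftPath, Matrix.diagonal_apply_eq]
    simp [levels, rPar]
    linear_combination (1 / 3) * sqrt_three_sq
  · simp [schroedinger_idEntries, driftPath]
  · simp [schroedinger_idEntries, driftPath]

/-- Diagonal entries do not move in the interaction picture, so this is the single equation `-b +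
(√3/2) c - (√3/2) r d = 0`, which determines `b`. -/
theorem overlap_interaction (ε γ s : ℝ) :
    overlap γ (schroedinger 4 (interaction (levels ε) control s) (idEntries 4)) = 0 := by
  rw [overlap_of_corner_eq_zero]
  · simp only [schroedinger_idEntries, interaction_apply_self, control_apply]
    simp [controlReal, rPar, bPar, cPar, dPar]
    linear_combination (5 / 6) * sqrt_three_sq
  · simp [schroedinger_idEntries, interaction, control_apply, controlReal]
  · simp [schroedinger_idEntries, interaction, control_apply, controlReal]

theorem overlap_drift_drift (ε γ t s : ℝ) :
    overlap γ (schroedinger 4 (driftPath (levels ε) t)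
      (schroedinger 4 (driftPath (levels ε) s) (idEntries 4))) = -(1 / 4) * timeCoeff ε := by
  rw [overlap_of_corner_eq_zero]
  · simp only [schroedinger_schroedinger_idEntries, driftPath, Matrix.diagonal_mul_diagonal,
      Matrix.diagonal_apply_eq, ← ofReal_mul, neg_re, neg_im, ofReal_re, ofReal_im]
    simp [levels, timeCoeff, rPar]
    ring
  · simp [schroedinger_schroedinger_idEntries, driftPath]
  · simp [schroedinger_schroedinger_idEntries, driftPath]

/-- The condition is `c + (3/2) r d = 0`, which determines `c`. It decouples `ℓ` from `f` in the
Hessian. -/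
theorem overlap_drift_interaction (ε γ t s : ℝ) :
    overlap γ (schroedinger 4 (driftPath (levels ε) t)
      (schroedinger 4 (interaction (levels ε) control s) (idEntries 4))) = 0 := by
  rw [overlap_of_corner_eq_zero]
  · simp only [schroedinger_schroedinger_idEntries, driftPath, Matrix.diagonal_mul,
      interaction_apply_self, control_apply, ← ofReal_mul, neg_re, neg_im, ofReal_re, ofReal_im]
    simp [levels, controlReal, cPar, dPar, rPar]
    ring
  · simp [schroedinger_schroedinger_idEntries, driftPath, interaction, control_apply, controlReal]
  · simp [schroedinger_schroedinger_idEntries, driftPath, interaction, control_apply, controlReal]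

theorem overlap_interaction_drift (ε γ t s : ℝ) :
    overlap γ (schroedinger 4 (interaction (levels ε) control t)
      (schroedinger 4 (driftPath (levels ε) s) (idEntries 4))) = 0 := by
  rw [overlap_of_corner_eq_zero]
  · simp only [schroedinger_schroedinger_idEntries, driftPath, Matrix.mul_diagonal,
      interaction_apply_self, control_apply, ← ofReal_mul, neg_re, neg_im, ofReal_re, ofReal_im]
    simp [levels, controlReal, cPar, dPar, rPar]
    ring
  · simp [schroedinger_schroedinger_idEntries, driftPath, interaction, control_apply, controlReal]
  · simp [schroedinger_schroedinger_idEntries, driftPath, interaction, control_apply, controlReal]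

theorem gPar_sq : gPar * gPar = 3 / 71 * (19 + 12 * √3) :=
  Real.mul_self_sqrt (by positivity)

/-- The transitions from level `0` to `1` and back give `r cos εu` and `-sin εu`, while those among
levels `1`, `2`, `3` have frequency one. The entry `b²` is real and is weighted by an imaginary
part, so it drops out. -/
theorem overlap_interaction_interaction (ε γ t s : ℝ) :
    overlap γ (schroedinger 4 (interaction (levels ε) control t)
      (schroedinger 4 (interaction (levels ε) control s) (idEntries 4))) =
      -(1 / 4) * trigKernel (9 - 4 * √3) rPar (1 + √3 / 3) ε (t - s) := by
  rw [overlap_of_corner_eq_zero]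
  · simp only [schroedinger_schroedinger_idEntries, neg_re, neg_im, interaction_control_mul_re,
      interaction_control_mul_im, Fin.sum_univ_four]
    have e0 : ((1 : ℝ) - (1 + ε)) * (t - s) = -(ε * (t - s)) := by ring
    have e1 : ((1 : ℝ) - 2) * (t - s) = -(t - s) := by ring
    have e2 : ((2 : ℝ) - 1) * (t - s) = t - s := by ring
    have e3 : ((2 : ℝ) - 3) * (t - s) = -(t - s) := by ring
    have e4 : ((3 : ℝ) - 2) * (t - s) = t - s := by ring
    have e5 : ((1 : ℝ) + ε - 1) * (t - s) = ε * (t - s) := by ring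
    simp only [levels, controlReal, trigKernel, Matrix.of_apply, Matrix.cons_val, Real.sin_neg,
      Real.cos_neg, e0, e1, e2, e3, e4, e5, sub_self, zero_mul, mul_zero, Real.sin_zero,
      Real.cos_zero, mul_one, one_mul, zero_add, add_zero]
    -- This is the equation that determines `g`: it makes the coefficient `-1 - √3/2 + (√3/2) g² (1
    -- + r)` of `sin (t - s)` vanish.
    have hk : gPar * gPar * (1 + rPar) = 1 + 2 * √3 / 3 := by
      rw [gPar_sq, rPar]
      linear_combination (-8 / 71) * sqrt_three_sq
    have hc : cPar * cPar / 2 + rPar * (dPar * dPar) / 2 = 9 - 4 * √3 := by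
      rw [cPar, dPar, rPar]
      linear_combination (1 / 2) * sqrt_three_sq
    linear_combination (-(1 / 8) * Real.cos (t - s) - √3 / 8 * Real.sin (t - s)) * hk -
      (1 / 4) * hc - (1 / 12) * Real.sin (t - s) * sqrt_three_sq
  · simp [schroedinger_schroedinger_idEntries, interaction, control_apply, controlReal,
      Matrix.mul_apply, Fin.sum_univ_four]
  · simp [schroedinger_schroedinger_idEntries, interaction, control_apply, controlReal,
      Matrix.mul_apply, Fin.sum_univ_four]

/-- The first-order integrand vanishes at each time, not merely after integration. -/
theorem fderiv_fidelity_eq_zero {ε : ℝ} (hε : 0 < ε) (γ : ℝ) :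
    fderiv ℝ (fidelity ε γ) (1, 0) = 0 := by
  refine ContinuousLinearMap.ext fun v => ?_
  rw [fderiv_fidelity hε, resolventFidelity_apply, interactionGenerator, generator_apply]
  have hint := intervalIntegrable_generator (finalTime_nonneg hε)
    (continuous_schroedinger (continuous_driftPath (levels ε)))
    (continuous_schroedinger (continuous_interaction (levels ε) control)) v
    (ContinuousMap.const _ (idEntries 4)) (endTime hε).2
  rw [← (overlap γ).intervalIntegral_comp_comm hint]
  refine (intervalIntegral.integral_congr fun s _ => ?_).trans intervalIntegral.integral_zero
  change overlap γ (v.1 • schroedinger 4 _ (idEntries 4) + v.2 s • schroedinger 4 _ (idEntries 4))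
    = 0
  rw [map_add, map_smul, map_smul, overlap_drift, overlap_interaction, smul_zero, smul_zero,
    add_zero]

/-- The left factor acts at the later time, so `b` sits in the inner integral. The triangle gives
`T²/2`, which the other operator order completes to `T²`. -/
theorem resolventFidelity_mul {ε : ℝ} (hε : 0 < ε) (γ : ℝ) (a b : ℝ × Control (finalTime ε)) :
    resolventFidelity hε γ (interactionGenerator hε a * interactionGenerator hε b) =
      -(1 / 4) * (timeCoeff ε * a.1 * b.1 * (finalTime ε ^ 2 / 2) +
        causalForm (finalTime ε) (trigKernel (9 - 4 * √3) rPar (1 + √3 / 3) ε) b.2 a.2) := by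
  have hT := finalTime_nonneg hε
  have hA := continuous_schroedinger (continuous_driftPath (levels ε))
  have hB := continuous_schroedinger (continuous_interaction (levels ε) control)
  set c : C(Set.Icc 0 (finalTime ε), Fin 4 → Fin 4 → ℂ) :=
    ContinuousMap.const _ (idEntries 4) with hcdef
  have hmul : (interactionGenerator hε a * interactionGenerator hε b) c (endTime hε) =
      interactionGenerator hε a (interactionGenerator hε b c) (endTime hε) := rfl
  rw [resolventFidelity_apply, ← hcdef, hmul, interactionGenerator, generator_apply,
    ← (overlap γ).intervalIntegral_comp_comm
      (intervalIntegrable_generator hT hA hB a _ (endTime hε).2)]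
  have hpt : ∀ t ∈ Set.uIcc (0 : ℝ) (endTime hε), overlap γ (a.1 • schroedinger 4
      (driftPath (levels ε) t) (Set.IccExtend hT (generator hT _ _ hA hB b c) t) +
      a.2 t • schroedinger 4 (interaction (levels ε) control t)
        (Set.IccExtend hT (generator hT _ _ hA hB b c) t)) =
      -(1 / 4) * (timeCoeff ε * a.1 * b.1 * t + a.2 t * ∫ s in (0 : ℝ)..t,
        trigKernel (9 - 4 * √3) rPar (1 + √3 / 3) ε (t - s) * b.2 s) := by
    intro t ht
    have ht' : t ∈ Set.Icc 0 (finalTime ε) := by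
      rwa [Set.uIcc_of_le (endTime hε).2.1] at ht
    have hbt := b.2.intervalIntegrable_of_mem ht'
    have hk : IntervalIntegrable (fun s => trigKernel (9 - 4 * √3) rPar (1 + √3 / 3) ε (t - s) *
        b.2 s) volume 0 t := hbt.continuousOn_mul (by unfold trigKernel; fun_prop)
    rw [Set.IccExtend_of_mem hT _ ht', generator_apply]
    -- For fixed outer time `t`, the functional composed with the outer generator is continuous and
    -- linear, so it passes under the inner integral.
    set Q : (Fin 4 → Fin 4 → ℂ) →L[ℝ] ℝ := (overlap γ).comp
      (a.1 • schroedinger 4 (driftPath (levels ε) t) +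
        a.2 t • schroedinger 4 (interaction (levels ε) control t)) with hQ
    have hQa : ∀ X, overlap γ (a.1 • schroedinger 4 (driftPath (levels ε) t) X +
        a.2 t • schroedinger 4 (interaction (levels ε) control t) X) = Q X := fun X => rfl
    rw [hQa, ← Q.intervalIntegral_comp_comm (intervalIntegrable_generator hT hA hB b c ht')]
    have hs : ∀ s, Q (b.1 • schroedinger 4 (driftPath (levels ε) s) (Set.IccExtend hT c s) +
        b.2 s • schroedinger 4 (interaction (levels ε) control s) (Set.IccExtend hT c s)) =
        -(1 / 4) * (timeCoeff ε * a.1 * b.1) + (-(1 / 4) * a.2 t) *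
          (trigKernel (9 - 4 * √3) rPar (1 + √3 / 3) ε (t - s) * b.2 s) := by
      intro s
      have hc : Set.IccExtend hT c s = idEntries 4 := rfl
      rw [hc, map_add, map_smul, map_smul, ← hQa, ← hQa, map_add, map_add, map_smul, map_smul,
        map_smul, map_smul, overlap_drift_drift, overlap_drift_interaction,
        overlap_interaction_drift, overlap_interaction_interaction]
      simp only [smul_eq_mul]
      ring
    simp only [hs]
    rw [intervalIntegral.integral_add (by simp) (hk.const_mul _),
      intervalIntegral.integral_const_mul (-(1 / 4) * a.2 t), intervalIntegral.integral_const]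
    simp only [smul_eq_mul, sub_zero]
    ring
  rw [intervalIntegral.integral_congr hpt, intervalIntegral.integral_const_mul]
  have hi := intervalIntegrable_causal_trigKernel (9 - 4 * √3) rPar (1 + √3 / 3) ε
    (b.2.intervalIntegrable hT) (a.2.intervalIntegrable hT)
  change -(1 / 4) * (∫ t in (0 : ℝ)..finalTime ε, (timeCoeff ε * a.1 * b.1 * t +
    a.2 t * ∫ s in (0 : ℝ)..t, trigKernel (9 - 4 * √3) rPar (1 + √3 / 3) ε (t - s) * b.2 s)) = _
  rw [intervalIntegral.integral_add
    ((by fun_prop : Continuous fun t : ℝ => timeCoeff ε * a.1 * b.1 * t).intervalIntegrable _ _) hi,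
    intervalIntegral.integral_const_mul, integral_id, causalForm]
  ring

/-! ### The Hessian -/

theorem hessian_fidelity {ε : ℝ} (hε : 0 < ε) (γ ℓa ℓb : ℝ) (α β : Control (finalTime ε)) :
    ∃ S : ℝ, HasSum (fun k : ℕ => 4 / (Real.pi * (4 * ((k : ℝ) + 1) ^ 2 - 1)) *
        harmonicForm (2 * ((k : ℝ) + 1) * ε) α β) S ∧
      fderiv ℝ (fderiv ℝ (fidelity ε γ)) (1, 0) (ℓa, α) (ℓb, β) =
        -(1 / 4) * (timeCoeff ε * finalTime ε ^ 2 * ℓa * ℓb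
          + (9 - 4 * √3 - 2 / Real.pi) * projForm (fun _ => 1) α β
          + (1 + √3 / 3) * harmonicForm 1 α β
          + rPar * harmonicForm ε α β
          + S) := by
  refine ⟨_, hasSum_causalForm_trigKernel (9 - 4 * √3) rPar (1 + √3 / 3) hε α β, ?_⟩
  rw [fderiv_fderiv_fidelity hε, map_add, resolventFidelity_mul, resolventFidelity_mul]
  ring

theorem timeCoeff_ge {ε : ℝ} (hε : 0 < ε) : 7 / 2 ≤ timeCoeff ε := by
  have h1 : √3 < 1.74 := by rw [Real.sqrt_lt' (by norm_num)]; norm_num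
  have h2 := rPar_bounds.1
  have h3 : rPar = 2 / 9 * (3 - √3) := rfl
  unfold timeCoeff
  nlinarith [mul_pos h2 hε, mul_pos h2 (mul_pos hε hε)]

/-- The constant mode can afford the `2/π` spent on making the sine kernel a positive cosine series.
-/
theorem constCoeff_pos : 0 < 9 - 4 * √3 - 2 / Real.pi := by
  have h1 : √3 < 1.74 := by rw [Real.sqrt_lt' (by norm_num)]; norm_num
  have h2 : 2 / Real.pi < 1 := by
    rw [div_lt_one Real.pi_pos]
    linarith [Real.pi_gt_three]
  linarith

theorem projForm_self {T : ℝ} (h : ℝ → ℝ) (α : Control T) :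
    projForm h α α = (∫ t in (0 : ℝ)..T, h t * α t) ^ 2 := (pow_two _).symm

theorem harmonicForm_self {T : ℝ} (ω : ℝ) (α : Control T) :
    harmonicForm ω α α = (∫ t in (0 : ℝ)..T, Real.cos (ω * t) * α t) ^ 2 +
      (∫ t in (0 : ℝ)..T, Real.sin (ω * t) * α t) ^ 2 := by
  rw [harmonicForm, projForm_self, projForm_self]

theorem harmonicForm_self_nonneg {T : ℝ} (ω : ℝ) (α : Control T) : 0 ≤ harmonicForm ω α α := by
  rw [harmonicForm_self]; positivity

/-- All terms have one sign, so failure of negativity kills each of them. The `ℓ` term, the constant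
mode and the harmonics `2kε` already force `v = 0`; frequencies `1` and `ε` need only be
nonnegative. -/
theorem hessian_fidelity_neg {ε : ℝ} (hε : 0 < ε) (γ : ℝ) (v : ℝ × Control (finalTime ε))
    (hv : v ≠ 0) : fderiv ℝ (fderiv ℝ (fidelity ε γ)) (1, 0) v v < 0 := by
  obtain ⟨ℓ, α⟩ := v
  obtain ⟨S, hS, hH⟩ := hessian_fidelity hε γ ℓ ℓ α α
  have hT : 0 < finalTime ε := div_pos Real.pi_pos hε
  have hterm : ∀ k : ℕ, 0 ≤ 4 / (Real.pi * (4 * ((k : ℝ) + 1) ^ 2 - 1)) *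
      harmonicForm (2 * ((k : ℝ) + 1) * ε) α α := fun k =>
    mul_nonneg (sinCoeff_pos k).le (harmonicForm_self_nonneg _ _)
  have hS0 : 0 ≤ S := hS.nonneg hterm
  have h1 : 0 ≤ timeCoeff ε * finalTime ε ^ 2 * ℓ * ℓ := by
    have := timeCoeff_ge hε
    rw [mul_assoc, ← pow_two]
    positivity
  have h2 : 0 ≤ (9 - 4 * √3 - 2 / Real.pi) * projForm (fun _ => 1) α α := by
    rw [projForm_self]
    exact mul_nonneg constCoeff_pos.le (sq_nonneg _)
  have h3 : 0 ≤ (1 + √3 / 3) * harmonicForm 1 α α :=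
    mul_nonneg (by positivity) (harmonicForm_self_nonneg _ _)
  have h4 : 0 ≤ rPar * harmonicForm ε α α :=
    mul_nonneg rPar_bounds.1.le (harmonicForm_self_nonneg _ _)
  by_contra hcon
  rw [hH] at hcon
  have hℓ : timeCoeff ε * finalTime ε ^ 2 * ℓ * ℓ = 0 := by linarith
  have hP : (9 - 4 * √3 - 2 / Real.pi) * projForm (fun _ => 1) α α = 0 := by linarith
  have hSz : S = 0 := by linarith
  refine hv (Prod.ext ?_ ?_)
  · have hne : timeCoeff ε * finalTime ε ^ 2 ≠ 0 := by
      have := timeCoeff_ge hε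
      positivity
    rw [mul_assoc, mul_eq_zero, mul_self_eq_zero] at hℓ
    exact hℓ.resolve_left hne
  · rw [hSz] at hS
    have hz := (hasSum_zero_iff_of_nonneg hterm).1 hS
    have hz' : ∀ k : ℕ, harmonicForm (2 * ((k : ℝ) + 1) * ε) α α = 0 := fun k =>
      (mul_eq_zero.1 (congrFun hz k)).resolve_left (sinCoeff_pos k).ne'
    -- Since `T = π/ε`, the harmonics in the Hessian are exactly the Fourier frequencies of the
    -- interval.
    have hω : ∀ k : ℕ, 2 * Real.pi * ((k : ℝ) + 1) / finalTime ε = 2 * ((k : ℝ) + 1) * ε := by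
      intro k
      rw [finalTime]
      field_simp
    simp only [harmonicForm_self] at hz'
    refine Control.eq_zero_of_fourier hT α ?_ (fun k => ?_) fun k => ?_
    · rw [projForm_self, mul_eq_zero] at hP
      simpa using pow_eq_zero_iff two_ne_zero |>.1 (hP.resolve_left constCoeff_pos.ne')
    · rw [hω]
      exact pow_eq_zero_iff two_ne_zero |>.1
        ((add_eq_zero_iff_of_nonneg (sq_nonneg _) (sq_nonneg _)).1 (hz' k)).1
    · rw [hω]
      exact pow_eq_zero_iff two_ne_zero |>.1
        ((add_eq_zero_iff_of_nonneg (sq_nonneg _) (sq_nonneg _)).1 (hz' k)).2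

/-! ### Admissibility -/

theorem isHermitian_drift (ε : ℝ) : (drift ε).IsHermitian := by
  rw [drift_eq_diagonal, Matrix.isHermitian_diagonal_iff]
  intro i
  exact conj_ofReal _

theorem isHermitian_control : control.IsHermitian := by
  ext i j
  rw [Matrix.conjTranspose_apply, control_apply, control_apply]
  have h : controlReal j i = controlReal i j := by
    fin_cases i <;> fin_cases j <;> simp [controlReal]
  rw [h]
  exact conj_ofReal _

/-- The phase relation `hDA` is orthogonality of the first and last rows; everything else is
normalization. -/
theorem unitary_of_phases {r s : ℝ} (hrs : (r : ℂ) * r + (s : ℂ) * s = 1) {A B C D : ℂ}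
    (hA : A * (starRingEnd ℂ) A = 1) (hB : B * (starRingEnd ℂ) B = 1)
    (hC : C * (starRingEnd ℂ) C = 1) (hD : D * (starRingEnd ℂ) D = 1)
    (hDA : D * (starRingEnd ℂ) A = (starRingEnd ℂ) C) :
    !![(r : ℂ), 0, 0, (s : ℂ) * D; 0, -I, 0, 0; 0, 0, B, 0; -(s : ℂ) * C, 0, 0, (r : ℂ) * A] ∈
      Matrix.unitaryGroup (Fin 4) ℂ := by
  have hAD : A * (starRingEnd ℂ) D = C := by
    have := congrArg (starRingEnd ℂ) hDA
    rwa [map_mul, conj_conj, conj_conj, mul_comm] at this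
  rw [Matrix.mem_unitaryGroup_iff, Matrix.star_eq_conjTranspose]
  ext i j
  fin_cases i <;> fin_cases j <;>
    simp [Matrix.mul_apply, Fin.sum_univ_four]
  · linear_combination hrs + (s : ℂ) * s * hD
  · linear_combination (r : ℂ) * s * hDA
  · linear_combination hB
  · linear_combination (r : ℂ) * s * hAD
  · linear_combination hrs + (s : ℂ) * s * hC + (r : ℂ) * r * hA

theorem core_mem_unitaryGroup (γ : ℝ) : core γ ∈ Matrix.unitaryGroup (Fin 4) ℂ := by
  obtain ⟨hr0, hr1⟩ := rPar_bounds
  have hrs : (rPar : ℂ) * rPar + (√(1 - rPar ^ 2) : ℂ) * (√(1 - rPar ^ 2) : ℂ) = 1 := by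
    have h : rPar * rPar + √(1 - rPar ^ 2) * √(1 - rPar ^ 2) = 1 := by
      rw [Real.mul_self_sqrt (by nlinarith)]
      ring
    exact_mod_cast h
  refine unitary_of_phases hrs ?_ ?_ ?_ ?_ ?_ <;> rw [← Complex.exp_conj]
  iterate 4
    rw [← Complex.exp_add]
    simp
  rw [← Complex.exp_conj, ← Complex.exp_add]
  congr 1
  simp
  ring

theorem gate_mem_unitaryGroup (ε γ : ℝ) : gate ε γ ∈ Matrix.unitaryGroup (Fin 4) ℂ := by
  have h : gate ε γ = star (core γ *
      Matrix.diagonal fun i => exp (I * levels ε i * finalTime ε)) := by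
    rw [← conjTranspose_gate, Matrix.star_eq_conjTranspose, Matrix.conjTranspose_conjTranspose]
  rw [h]
  refine Unitary.star_mem (Submonoid.mul_mem _ (core_mem_unitaryGroup γ) ?_)
  rw [Matrix.mem_unitaryGroup_iff, Matrix.star_eq_conjTranspose, Matrix.diagonal_conjTranspose,
    Matrix.diagonal_mul_diagonal, ← Matrix.diagonal_one]
  congr 1
  funext i
  simp only [Pi.star_apply, RCLike.star_def]
  rw [← Complex.exp_conj, ← Complex.exp_add]
  simp

end

end QuantumTrap

/-! ### The variable-time trap. -/

theorem mainTheorem4 (ε : ℝ) (hε : 0 < ε) (γ : ℝ) :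
    -- an admissible control problem: Hermitian Hamiltonians and a unitary target gate
    (QuantumTrap.drift ε).IsHermitian ∧ QuantumTrap.control.IsHermitian ∧
    QuantumTrap.gate ε γ ∈ Matrix.unitaryGroup (Fin 4) ℂ ∧
    -- the Schroedinger equation has exactly one solution on `[0,T]` for all `(ℓ, f)`
    (∀ (ℓ : ℝ) (f : QuantumTrap.Control (QuantumTrap.finalTime ε)),
      ∃ U, QuantumTrap.IsPropagator (QuantumTrap.drift ε) QuantumTrap.control
          (QuantumTrap.finalTime ε) ℓ f U ∧
        ∀ U', QuantumTrap.IsPropagator (QuantumTrap.drift ε) QuantumTrap.control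
            (QuantumTrap.finalTime ε) ℓ f U' →
          Set.EqOn U' U (Set.Icc 0 (QuantumTrap.finalTime ε))) ∧
    -- the fidelity at `ℓ = 1`, `f = 0`, also on the scale that runs from 0 to 1
    QuantumTrap.fidelity ε γ (1, 0) = (9 - 2 * √3) / 24 ∧
    (1 + QuantumTrap.fidelity ε γ (1, 0)) / 2 = (33 - 2 * √3) / 48 ∧
    -- `ℓ = 1`, `f = 0` is a critical point
    ContDiffAt ℝ 2 (QuantumTrap.fidelity ε γ) (1, 0) ∧
    fderiv ℝ (QuantumTrap.fidelity ε γ) (1, 0) = 0 ∧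
    -- the Hessian
    (∀ (ℓa ℓb : ℝ) (α β : QuantumTrap.Control (QuantumTrap.finalTime ε)),
      ∃ S : ℝ,
        HasSum (fun k : ℕ => 4 / (Real.pi * (4 * ((k : ℝ) + 1) ^ 2 - 1)) *
          QuantumTrap.harmonicForm (2 * ((k : ℝ) + 1) * ε) α β) S ∧
        fderiv ℝ (fderiv ℝ (QuantumTrap.fidelity ε γ)) (1, 0) (ℓa, α) (ℓb, β) =
          -(1 / 4) * (QuantumTrap.timeCoeff ε * QuantumTrap.finalTime ε ^ 2 * ℓa * ℓb
            + (9 - 4 * √3 - 2 / Real.pi) * QuantumTrap.projForm (fun _ => 1) α β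
            + (1 + √3 / 3) * QuantumTrap.harmonicForm 1 α β
            + QuantumTrap.rPar * QuantumTrap.harmonicForm ε α β
            + S)) ∧
    7 / 2 ≤ QuantumTrap.timeCoeff ε ∧
    -- the Hessian is negative definite
    (∀ v : ℝ × QuantumTrap.Control (QuantumTrap.finalTime ε), v ≠ 0 →
      fderiv ℝ (fderiv ℝ (QuantumTrap.fidelity ε γ)) (1, 0) v v < 0) ∧
    -- strict local maximum over every finite-dimensional subspace
    (∀ E : Submodule ℝ (ℝ × QuantumTrap.Control (QuantumTrap.finalTime ε)),
      FiniteDimensional ℝ E →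
      ∀ᶠ v : E in nhds 0, v ≠ 0 →
        QuantumTrap.fidelity ε γ ((1, 0) + (v : ℝ × QuantumTrap.Control (QuantumTrap.finalTime ε)))
          < QuantumTrap.fidelity ε γ (1, 0)) ∧
    -- not a global maximum, even among positive `ℓ`
    (∃ p : ℝ × QuantumTrap.Control (QuantumTrap.finalTime ε), 0 < p.1 ∧
      QuantumTrap.fidelity ε γ (1, 0) < QuantumTrap.fidelity ε γ p) := by
  have hT := QuantumTrap.finalTime_nonneg hε
  have hC2 := (QuantumTrap.contDiff_fidelity hε γ (n := 2)).contDiffAt (x := (1, 0))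
  have hval := QuantumTrap.fidelity_one_zero hε γ
  refine ⟨QuantumTrap.isHermitian_drift ε, QuantumTrap.isHermitian_control,
    QuantumTrap.gate_mem_unitaryGroup ε γ, fun ℓ f => ?_, hval, ?_, hC2,
    QuantumTrap.fderiv_fidelity_eq_zero hε γ, QuantumTrap.hessian_fidelity hε γ,
    QuantumTrap.timeCoeff_ge hε, QuantumTrap.hessian_fidelity_neg hε γ, fun E hE => ?_,
    QuantumTrap.exists_fidelity_lt hε γ⟩
  · have hU := QuantumTrap.isPropagator_gate hε (ℓ, f)
    refine ⟨_, hU, fun U' hU' t ht => ?_⟩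
    exact (hU'.eqOn_evolution hT ⟨t, ht⟩).trans (hU.eqOn_evolution hT ⟨t, ht⟩).symm
  · rw [hval]
    ring
  · exact QuantumTrap.eventually_lt_of_hessian_neg hC2
      (QuantumTrap.fderiv_fidelity_eq_zero hε γ) (QuantumTrap.hessian_fidelity_neg hε γ) E
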